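/- Let $m\ge 1$ and $n\ge 2$ be integers, and let $\mathcal H_{m,n}=L^2(\mathrm{Mat}_{\mathbb R}^{m,n},\mathbb C)$ be the Hilbert space of square-integrable functions of a real $m\times n$ matrix $X=(x_{i,j})$ (with respect to Lebesgue measure). For $1\le i\le m$ and $1\le j\le n$ let $\hat a_{i,j}f=\frac1{\sqrt2}\bigl(x_{i,j}f+\partial f/\partial x_{i,j}\bigr)$ be the annihilation operator on Schwartz functions, and let $\hat a_{i,j}^*$ be its adjoint. For $1\le j,k\le n$ let $\hat v_{j,k}$ be the closure of the operator $\sum_{i=1}^m(\hat a_{i,k}^*\hat a_{i,j}-\hat a_{i,j}^*\hat a_{i,k})$ on Schwartz functions. For $1\le k\le n-1$ put $\hat r_k=\arctan(\sqrt k)\,\hat v_{k,k+1}$, $\hat R_k=\exp(\hat r_k)$ and $\hat R=\hat R_{n-1}\hat R_{n-2}\cdots\hat R_1$, where $\exp(\hat r_k)$ is the value at time $1$ of the strongly continuous one-parameter unitary group with generator $\hat r_k$. Define, on its natural domain, $$\hat T_{\rm inv}=\sum_{k=1}^{n-1}\hat R^*\hat v_{k,n}\hat v_{k,n}^*\hat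 R,\qquad \mathcal K_0=\{f\in\operatorname{dom}\hat T_{\rm inv}\mid\langle f,\hat T_{\rm inv}f\rangle\le 0\}.$$ **Theorem.** Each $\hat r_k$ generates a strongly continuous one-parameter unitary group (so that $\hat R$ is well defined), and $\mathcal K_0$ is the null space $\{f\in\operatorname{dom}\hat T_{\rm inv}\mid\hat T_{\rm inv}f=0\}$ of $\hat T_{\rm inv}$. Moreover, $\mathcal K_0$ is exactly the set of all $f\in\mathcal H_{m,n}$ that are mode-wisely rotationally invariant, i.e. such that $f(X)=f(Xe^A)$ for almost every $X$, for every real antisymmetric $n\times n$ matrix $A$. If $m=1$, then $\mathcal K_0$ is exactly the set of square-integrable radial functions, i.e. of the $f\in\mathcal H_{1,n}$ for which there is a function $g$ on $\mathbb R$ with $f(X)=g(\|X\|)$ for almost every $X$, where $\|\cdot\|$ is the Euclidean norm. -/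

import Mathlib

open MeasureTheory SchwartzMap
open scoped LineDeriv Matrix

noncomputable section

/-! ### Unbounded operators on a complex Hilbert space -/

section Operators

variable {H : Type*} [NormedAddCommGroup H] [InnerProductSpace ℂ H]

/-- The composition `S ∘ T` of two unbounded operators, on its natural domain
`{f ∈ dom T | T f ∈ dom S}`. -/
def opComp (S T : H →ₗ.[ℂ] H) : H →ₗ.[ℂ] H :=
  S.comp (T.domRestrict ((S.domain.comap T.toFun).map T.domain.subtype)) (by
    rintro ⟨x, hx, hT⟩
    obtain ⟨y, hy, rfl⟩ := hx
    exact hy)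

theorem mem_opComp_domain (S T : H →ₗ.[ℂ] H) (f : H) :
    f ∈ (opComp S T).domain ↔ ∃ h : f ∈ T.domain, T ⟨f, h⟩ ∈ S.domain := by
  constructor
  · rintro ⟨⟨y, hy, rfl⟩, _⟩
    exact ⟨y.2, hy⟩
  · rintro ⟨h, h'⟩
    exact ⟨⟨⟨f, h⟩, h', rfl⟩, h⟩

theorem opComp_apply (S T : H →ₗ.[ℂ] H) (f : H) (h : f ∈ (opComp S T).domain)
    (hT : f ∈ T.domain) (hS : T ⟨f, hT⟩ ∈ S.domain) :
    opComp S T ⟨f, h⟩ = S ⟨T ⟨f, hT⟩, hS⟩ := rfl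

/-- A bounded operator, regarded as an operator with domain the whole space. -/
def ofBounded (B : H →L[ℂ] H) : H →ₗ.[ℂ] H := (B : H →ₗ[ℂ] H).toPMap ⊤

variable [CompleteSpace H]

/-- `U` is a strongly continuous one-parameter unitary group whose infinitesimal generator is
`L`: a vector `f` belongs to the domain of `L`, with `L f = g`, if and only if `t ↦ U t f` has
derivative `g` at `t = 0`. In other words `U t = exp (t L)`. -/
structure IsUnitaryGroupOf (L : H →ₗ.[ℂ] H) (U : ℝ → unitary (H →L[ℂ] H)) : Prop where
  map_zero : U 0 = 1
  map_add : ∀ s t : ℝ, U (s + t) = U s * U t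
  continuous : ∀ f : H, Continuous fun t : ℝ => (U t : H →L[ℂ] H) f
  generator : ∀ f g : H,
    (f, g) ∈ L.graph ↔ HasDerivAt (fun t : ℝ => (U t : H →L[ℂ] H) f) g 0

open Classical in
/-- The unitary operator `exp L` of a (generally unbounded) operator `L` that generates a strongly
continuous one-parameter unitary group, that is, of a skew-adjoint operator. (The value `1` is
used for an `L` that generates no such group.) -/
def unitaryExp (L : H →ₗ.[ℂ] H) : unitary (H →L[ℂ] H) :=
  if h : ∃ U : ℝ → unitary (H →L[ℂ] H), IsUnitaryGroupOf L U then h.choose 1 else 1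

end Operators

/-! ### Real matrices and functions of a real matrix variable -/

/-- The space of real `m × n` matrices `X = (x_{i,j})` with the Frobenius norm
`‖X‖² = ∑ x_{i,j}²` and with Lebesgue measure. -/
abbrev MatSpace (m n : ℕ) : Type := EuclideanSpace ℝ (Fin m × Fin n)

namespace MatSpace

/-- The matrix with the given entries. -/
def toMatrix {m n : ℕ} (X : MatSpace m n) : Matrix (Fin m) (Fin n) ℝ :=
  Matrix.of fun i j => X (i, j)

/-- The matrix product `X ↦ X B`. -/
def mulRight {m n : ℕ} (X : MatSpace m n) (B : Matrix (Fin n) (Fin n) ℝ) : MatSpace m n :=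
  WithLp.toLp 2 fun p => (X.toMatrix * B) p.1 p.2

end MatSpace

/-- The Hilbert space of square-integrable functions of a real `m × n` matrix, canonically the
`mn`-fold Hilbert tensor power of `L²(ℝ)`. -/
abbrev HilbertMN (m n : ℕ) : Type := Lp ℂ 2 (volume : Measure (MatSpace m n))

/-! ### Annihilation operators and the operators built from them -/

section Modes

variable {m n : ℕ}

/-- The operator `f ↦ (x_{i,j} f + ∂f/∂x_{i,j}) / √2` on Schwartz functions. -/
def annihilationSchwartz (i : Fin m) (j : Fin n) :
    𝓢(MatSpace m n, ℂ) →ₗ[ℂ] 𝓢(MatSpace m n, ℂ) :=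
  ((Real.sqrt 2 : ℝ) : ℂ)⁻¹ •
    ((smulLeftCLM ℂ (fun X : MatSpace m n => ((X (i, j) : ℝ) : ℂ))).toLinearMap +
      (LineDeriv.lineDerivOpCLM ℂ 𝓢(MatSpace m n, ℂ)
        (EuclideanSpace.single (i, j) (1 : ℝ))).toLinearMap)

theorem annihilationSchwartz_apply (i : Fin m) (j : Fin n) (f : 𝓢(MatSpace m n, ℂ))
    (X : MatSpace m n) :
    annihilationSchwartz i j f X =
      (X (i, j) * f X + lineDeriv ℝ f X (EuclideanSpace.single (i, j) 1)) / Real.sqrt 2 := by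
  have h : (fun X : MatSpace m n => ((X (i, j) : ℝ) : ℂ)).HasTemperateGrowth := by
    have : (fun X : MatSpace m n => ((X (i, j) : ℝ) : ℂ)) =
        (Complex.ofRealCLM ∘L (EuclideanSpace.proj (i, j) : MatSpace m n →L[ℝ] ℝ)) := by
      ext X; simp
    rw [this]
    exact ContinuousLinearMap.hasTemperateGrowth _
  simp only [annihilationSchwartz, LinearMap.smul_apply, LinearMap.add_apply,
    ContinuousLinearMap.coe_coe, _root_.smul_apply, _root_.add_apply,
    smulLeftCLM_apply_apply h, smul_eq_mul, LineDeriv.lineDerivOpCLM_apply,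
    SchwartzMap.lineDerivOp_apply]
  rw [div_eq_inv_mul]

/-- The inclusion of Schwartz functions into `L²`. -/
def schwartzToL2 (m n : ℕ) : 𝓢(MatSpace m n, ℂ) →ₗ[ℂ] HilbertMN m n :=
  (toLpCLM ℂ ℂ 2 (volume : Measure (MatSpace m n))).toLinearMap

theorem schwartzToL2_injective (m n : ℕ) : Function.Injective (schwartzToL2 m n) :=
  injective_toLp 2 (volume : Measure (MatSpace m n))

/-- The annihilation operator `a_{i,j}`, densely defined on Schwartz functions by
`a_{i,j} f = (x_{i,j} f + ∂f/∂x_{i,j}) / √2`. -/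
def annihilation (i : Fin m) (j : Fin n) : HilbertMN m n →ₗ.[ℂ] HilbertMN m n where
  domain := LinearMap.range (schwartzToL2 m n)
  toFun := schwartzToL2 m n ∘ₗ annihilationSchwartz i j ∘ₗ
    (LinearEquiv.ofInjective (schwartzToL2 m n) (schwartzToL2_injective m n)).symm.toLinearMap

theorem annihilation_apply (i : Fin m) (j : Fin n) (f : 𝓢(MatSpace m n, ℂ)) :
    annihilation i j ⟨schwartzToL2 m n f, f, rfl⟩ =
      schwartzToL2 m n (annihilationSchwartz i j f) := by
  have : (LinearEquiv.ofInjective (schwartzToL2 m n) (schwartzToL2_injective m n)).symm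
      ⟨schwartzToL2 m n f, f, rfl⟩ = f := by
    rw [LinearEquiv.symm_apply_eq]; rfl
  exact congrArg (fun g => schwartzToL2 m n (annihilationSchwartz i j g)) this

/-- The closed operator `v_{j,k} = ∑ᵢ (a_{i,k}^* a_{i,j} - a_{i,j}^* a_{i,k})`: the closure of the
differential operator given by this formula on Schwartz functions. -/
def vOp (j k : Fin n) : HilbertMN m n →ₗ.[ℂ] HilbertMN m n :=
  (∑ i : Fin m,
    (opComp (annihilation i k).adjoint (annihilation i j) -
      opComp (annihilation i j).adjoint (annihilation i k))).closure

end Modes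

section Tinv

variable (m n : ℕ)

/-- The operators `r_1, …, r_{n-1}`, where `r_k = arctan(√k) v_{k,k+1}`. The index `k` of `Fin`
stands for the number `k + 1`, since the rows and columns are counted from `0`. -/
def rOp (k : Fin (n - 1)) : HilbertMN m n →ₗ.[ℂ] HilbertMN m n :=
  ((Real.arctan (Real.sqrt ((k : ℝ) + 1)) : ℝ) : ℂ) •
    vOp ⟨k.1, by have := k.2; omega⟩ ⟨k.1 + 1, by have := k.2; omega⟩

/-- The unitary operator `R = R_{n-1} R_{n-2} ⋯ R_1`, where `R_k = exp r_k`. -/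
def ROp : unitary (HilbertMN m n →L[ℂ] HilbertMN m n) :=
  (List.ofFn fun k : Fin (n - 1) => unitaryExp (rOp m n k)).reverse.prod

/-- The operators `v_{1,n}, …, v_{n-1,n}`. -/
def vLast (k : Fin (n - 1)) : HilbertMN m n →ₗ.[ℂ] HilbertMN m n :=
  vOp ⟨k.1, by have := k.2; omega⟩ ⟨n - 1, by have := k.2; omega⟩

/-- The observable `T_inv = ∑_{k=1}^{n-1} R^* v_{k,n} v_{k,n}^* R`. -/
def TInv : HilbertMN m n →ₗ.[ℂ] HilbertMN m n :=
  ∑ k : Fin (n - 1),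
    opComp (ofBounded (star (ROp m n) : HilbertMN m n →L[ℂ] HilbertMN m n))
      (opComp (vLast m n k)
        (opComp (vLast m n k).adjoint
          (ofBounded (ROp m n : HilbertMN m n →L[ℂ] HilbertMN m n))))

/-- The set `K_t` of the vectors `f` with `⟨f, T_inv f⟩ ≤ t ‖f‖²`. -/
def KSet (t : ℝ) : Set (HilbertMN m n) :=
  {f | ∃ h : f ∈ (TInv m n).domain, (inner ℂ f (TInv m n ⟨f, h⟩)).re ≤ t * ‖f‖ ^ 2}

/-- The null space `{f ∈ dom L | L f = 0}` of an operator. -/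
def nullSpace {m n : ℕ} (L : HilbertMN m n →ₗ.[ℂ] HilbertMN m n) : Set (HilbertMN m n) :=
  {f | ∃ h : f ∈ L.domain, L ⟨f, h⟩ = 0}

end Tinv

section Invariance

variable {m n : ℕ}

/-- A square-integrable function `f` is mode-wisely rotationally invariant if, for every real
antisymmetric matrix `A`, the functions `X ↦ f(X)` and `X ↦ f(X e^A)` are equal (as elements of
`L²`, that is, almost everywhere). -/
def IsMwRI (f : HilbertMN m n) : Prop :=
  ∀ A : Matrix (Fin n) (Fin n) ℝ, Aᵀ = -A →
    ∀ᵐ X : MatSpace m n, f X = f (X.mulRight (NormedSpace.exp A))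

/-- A square-integrable function is radial if `f(X) = g(‖X‖)` for some function `g` of a real
variable. -/
def IsRadial (f : HilbertMN m n) : Prop :=
  ∃ g : ℝ → ℂ, ∀ᵐ X : MatSpace m n, f X = g ‖X‖

end Invariance

end

/-!
By the canonical commutation relations, `v_{j,k}` acts on Schwartz functions as the derivative along
the linear vector field `X ↦ X (E_{kj} - E_{jk})`, whose flow consists of rotations. Schwartz
functions are a core for the generator of the unitary group of compositions with these rotations, so
this group is generated by `v_{j,k}`.

Since `⟨f, T_inv f⟩ = ∑ₖ ‖v_{k,n}^* R f‖²`, a function `f` of `K₀` has `v_{k,n}^* R f = 0` for all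
`k`. The matrices `B` such that a given function is weakly annihilated by the derivative along
`X ↦ X B` form a Lie algebra, and the matrices belonging to `v_{1,n}, …, v_{n-1,n}` generate the Lie
algebra of antisymmetric matrices; hence `R f` is invariant under all rotations. As `R` is itself a
product of rotations, it fixes every invariant function, and so `f = R f` is invariant.

For `m = 1` the rotations act transitively on spheres. An invariant function is defined only almost
everywhere, but its averages over balls are invariant at every point, and by Lebesgue's
differentiation theorem they recover the function.
-/

noncomputable section

/-! ### One-parameter unitary groups -/

section UnitaryGroups

variable {H : Type*} [NormedAddCommGroup H] [InnerProductSpace ℂ H] [CompleteSpace H]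
  {L T : H →ₗ.[ℂ] H} {U V : ℝ → unitary (H →L[ℂ] H)}

/-- The infinitesimal generator of a family `U` of operators: the derivative of `t ↦ U t f` at
`t = 0`, for those `f` for which it exists. -/
def unitaryGroupGenerator (U : ℝ → unitary (H →L[ℂ] H)) : H →ₗ.[ℂ] H where
  domain :=
    { carrier := {f | DifferentiableAt ℝ (fun t => (U t : H →L[ℂ] H) f) 0}
      add_mem' := fun hf hg => by simpa using hf.fun_add hg
      zero_mem' := by simp
      smul_mem' := fun c f hf => by simpa using hf.fun_const_smul c }
  toFun :=
    { toFun := fun f => deriv (fun t => (U t : H →L[ℂ] H) f) 0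
      map_add' := fun f g => by simpa using deriv_fun_add f.2 g.2
      map_smul' := fun c f => by simpa using deriv_fun_const_smul c f.2 }

theorem mem_graph_unitaryGroupGenerator {f g : H} :
    (f, g) ∈ (unitaryGroupGenerator U).graph ↔
      HasDerivAt (fun t => (U t : H →L[ℂ] H) f) g 0 := by
  rw [LinearPMap.mem_graph_iff]
  constructor
  · rintro ⟨y, rfl, rfl⟩
    exact y.2.hasDerivAt
  · exact fun h => ⟨⟨f, h.differentiableAt⟩, rfl, h.deriv⟩

theorem isUnitaryGroupOf_unitaryGroupGenerator (h_zero : U 0 = 1)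
    (h_add : ∀ s t, U (s + t) = U s * U t)
    (h_cont : ∀ f, Continuous fun t => (U t : H →L[ℂ] H) f) :
    IsUnitaryGroupOf (unitaryGroupGenerator U) U :=
  ⟨h_zero, h_add, h_cont, fun _ _ => mem_graph_unitaryGroupGenerator⟩

theorem eq_zero_of_hasDerivAt_self_of_norm_le {F : Type*} [NormedAddCommGroup F]
    [NormedSpace ℝ F] {c : ℝ → F} {C : ℝ} (hc : ∀ t, HasDerivAt c (c t) t)
    (hC : ∀ t, ‖c t‖ ≤ C) : c 0 = 0 := by
  have deriv_zero : ∀ t, HasDerivAt (fun t => Real.exp (-t) • c t) 0 t := fun t => by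
    simpa using (hasDerivAt_neg t).exp.fun_smul (hc t)
  have eq_exp_smul : ∀ t, c 0 = Real.exp (-t) • c t := fun t => by
    simpa using is_const_of_deriv_eq_zero (fun t => (deriv_zero t).differentiableAt)
      (fun t => (deriv_zero t).deriv) 0 t
  have norm_le : ∀ t, ‖c 0‖ ≤ Real.exp (-t) * C := fun t => by
    rw [eq_exp_smul t, norm_smul, Real.norm_of_nonneg (Real.exp_nonneg _)]
    exact mul_le_mul_of_nonneg_left (hC t) (Real.exp_nonneg _)
  have tendsto_zero : Filter.Tendsto (fun t => Real.exp (-t) * C) Filter.atTop (nhds 0) := by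
    simpa using Real.tendsto_exp_neg_atTop_nhds_zero.mul_const C
  exact norm_le_zero_iff.1 (ge_of_tendsto' tendsto_zero norm_le)

namespace IsUnitaryGroupOf

theorem zero_apply (hU : IsUnitaryGroupOf L U) (f : H) : (U 0 : H →L[ℂ] H) f = f := by
  simp [hU.map_zero]

theorem add_apply (hU : IsUnitaryGroupOf L U) (s t : ℝ) (f : H) :
    (U (s + t) : H →L[ℂ] H) f = (U s : H →L[ℂ] H) ((U t : H →L[ℂ] H) f) := by
  simp [hU.map_add]

theorem hasDerivAt (hU : IsUnitaryGroupOf L U) {f g : H} (hfg : (f, g) ∈ L.graph) (t : ℝ) :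
    HasDerivAt (fun t => (U t : H →L[ℂ] H) f) ((U t : H →L[ℂ] H) g) t := by
  have at_zero : HasDerivAt (fun s => (U s : H →L[ℂ] H) f) g (t - t) := by
    simpa using (hU.generator f g).1 hfg
  have translated := ((U t : H →L[ℂ] H).restrictScalars ℝ).hasFDerivAt.comp_hasDerivAt t
    (at_zero.comp_sub_const t t)
  simpa [Function.comp_def, ← hU.add_apply] using translated

theorem apply_mem_graph (hU : IsUnitaryGroupOf L U) {f g : H} (hfg : (f, g) ∈ L.graph) (t : ℝ) :
    ((U t : H →L[ℂ] H) f, (U t : H →L[ℂ] H) g) ∈ L.graph := by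
  rw [hU.generator]
  have at_zero := ((U t : H →L[ℂ] H).restrictScalars ℝ).hasFDerivAt.comp_hasDerivAt 0
    ((hU.generator f g).1 hfg)
  simpa [Function.comp_def, ← hU.add_apply, add_comm] using at_zero

theorem inner_add_inner_eq_zero (hU : IsUnitaryGroupOf L U) {f f' g g' : H}
    (hf : (f, f') ∈ L.graph) (hg : (g, g') ∈ L.graph) : inner ℂ f g' + inner ℂ f' g = 0 := by
  have hderiv := ((hU.generator f f').1 hf).inner ℂ ((hU.generator g g').1 hg)
  simp only [Unitary.inner_map_map, hU.zero_apply] at hderiv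
  exact hderiv.unique (hasDerivAt_const _ _)

theorem norm_le_norm_sub (hU : IsUnitaryGroupOf L U) {f g : H} (hfg : (f, g) ∈ L.graph) :
    ‖f‖ ≤ ‖f - g‖ := by
  have re_inner : (inner ℂ f g).re = 0 := by
    have h_sum := congrArg Complex.re (hU.inner_add_inner_eq_zero hfg hfg)
    have h_symm : (inner ℂ g f).re = (inner ℂ f g).re := inner_re_symm (𝕜 := ℂ) g f
    simp only [Complex.add_re, h_symm, Complex.zero_re] at h_sum
    linarith
  have pythagoras := norm_sub_sq (𝕜 := ℂ) f g
  simp only [RCLike.re_to_complex, re_inner] at pythagoras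
  exact le_of_sq_le_sq (by nlinarith [sq_nonneg ‖g‖]) (norm_nonneg _)

theorem mem_graph_iff_integral (hU : IsUnitaryGroupOf L U) {f g : H} :
    (f, g) ∈ L.graph ↔
      ∀ t : ℝ, ∫ s in (0 : ℝ)..t, (U s : H →L[ℂ] H) g = (U t : H →L[ℂ] H) f - f := by
  constructor
  · intro hfg t
    rw [intervalIntegral.integral_eq_sub_of_hasDerivAt (fun s _ => hU.hasDerivAt hfg s)
      ((hU.continuous g).intervalIntegrable _ _), hU.zero_apply]
  · intro h_integral
    have hderiv := ((hU.continuous g).integral_hasStrictDerivAt 0 0).hasDerivAt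
    simp only [h_integral, hU.zero_apply] at hderiv
    simpa [hU.generator] using hderiv.add_const f

theorem isClosed (hU : IsUnitaryGroupOf L U) : L.IsClosed := by
  have graph_eq : (L.graph : Set (H × H)) = ⋂ t : ℝ,
      {p | ∫ s in (0 : ℝ)..t, (U s : H →L[ℂ] H) p.2 = (U t : H →L[ℂ] H) p.1 - p.1} := by
    ext p
    simpa using hU.mem_graph_iff_integral (f := p.1) (g := p.2)
  have lipschitz_integral : ∀ t : ℝ, LipschitzWith ⟨|t|, abs_nonneg t⟩
      fun g : H => ∫ s in (0 : ℝ)..t, (U s : H →L[ℂ] H) g := by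
    refine fun t => LipschitzWith.of_dist_le_mul fun g g' => ?_
    rw [dist_eq_norm, dist_eq_norm, ← intervalIntegral.integral_sub
      ((hU.continuous g).intervalIntegrable _ _) ((hU.continuous g').intervalIntegrable _ _)]
    refine (intervalIntegral.norm_integral_le_of_norm_le_const (C := ‖g - g'‖)
      fun s _ => ?_).trans ?_
    · rw [← map_sub, Unitary.norm_map]
    · rw [sub_zero, mul_comm]; rfl
  rw [LinearPMap.IsClosed, graph_eq]
  exact isClosed_iInter fun t =>
    isClosed_eq ((lipschitz_integral t).continuous.comp continuous_snd) (by fun_prop)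

theorem integral_mem_graph (hU : IsUnitaryGroupOf L U) (f : H) (t : ℝ) :
    (∫ s in (0 : ℝ)..t, (U s : H →L[ℂ] H) f, (U t : H →L[ℂ] H) f - f) ∈ L.graph := by
  have hasDerivAt_integral (x : ℝ) :
      HasDerivAt (fun x => ∫ s in (0 : ℝ)..x, (U s : H →L[ℂ] H) f) ((U x : H →L[ℂ] H) f) x :=
    ((hU.continuous f).integral_hasStrictDerivAt 0 x).hasDerivAt
  have apply_integral (h : ℝ) : (U h : H →L[ℂ] H) (∫ s in (0 : ℝ)..t, (U s : H →L[ℂ] H) f) =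
      (∫ s in (0 : ℝ)..t + h, (U s : H →L[ℂ] H) f) - ∫ s in (0 : ℝ)..h, (U s : H →L[ℂ] H) f := by
    have integrable (a b : ℝ) := (hU.continuous f).intervalIntegrable (μ := volume) a b
    rw [intervalIntegral.integral_interval_sub_left (integrable _ _) (integrable _ _),
      ← ContinuousLinearMap.intervalIntegral_comp_comm _ (integrable _ _)]
    simp only [← hU.add_apply, add_comm h]
    rw [intervalIntegral.integral_comp_add_right (fun s => (U s : H →L[ℂ] H) f), zero_add]
  rw [hU.generator]
  simp only [apply_integral]
  have shifted := (hasDerivAt_integral (t + 0)).comp_const_add t 0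
  simpa [hU.zero_apply] using shifted.fun_sub (hasDerivAt_integral 0)

theorem dense_domain (hU : IsUnitaryGroupOf L U) : Dense (L.domain : Set H) := by
  intro f
  have hderiv := ((hU.continuous f).integral_hasStrictDerivAt 0 0).hasDerivAt
  rw [hasDerivAt_iff_tendsto_slope] at hderiv
  rw [hU.zero_apply] at hderiv
  refine mem_closure_of_tendsto hderiv (Filter.Eventually.of_forall fun t => ?_)
  have := LinearPMap.mem_domain_of_mem_graph (hU.integral_mem_graph f t)
  simpa [slope] using L.domain.smul_of_tower_mem (t⁻¹) this

theorem unique (hU : IsUnitaryGroupOf L U) (hV : IsUnitaryGroupOf L V) : U = V := by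
  have eq_on_domain : ∀ t, Set.EqOn (U t : H →L[ℂ] H) (V t : H →L[ℂ] H) L.domain := by
    intro t f hf
    obtain ⟨g, hfg⟩ := LinearPMap.mem_domain_iff.1 hf
    have deriv_zero : ∀ t, HasDerivAt
        (fun t => inner ℂ ((U t : H →L[ℂ] H) f) ((V t : H →L[ℂ] H) f)) 0 t := fun t =>
      ((hU.hasDerivAt hfg t).inner ℂ (hV.hasDerivAt hfg t)).congr_deriv
        (hU.inner_add_inner_eq_zero (hU.apply_mem_graph hfg t) (hV.apply_mem_graph hfg t))
    have inner_eq : inner ℂ ((U t : H →L[ℂ] H) f) ((V t : H →L[ℂ] H) f) = inner ℂ f f := by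
      simpa [hU.zero_apply, hV.zero_apply] using is_const_of_deriv_eq_zero
        (fun t => (deriv_zero t).differentiableAt) (fun t => (deriv_zero t).deriv) t 0
    have norm_sq := norm_sub_sq (𝕜 := ℂ) ((U t : H →L[ℂ] H) f) ((V t : H →L[ℂ] H) f)
    rw [inner_eq, inner_self_eq_norm_sq, Unitary.norm_map, Unitary.norm_map] at norm_sq
    exact sub_eq_zero.1 (norm_eq_zero.1 (sq_eq_zero_iff.1 (by linarith)))
  funext t
  exact Subtype.ext (DFunLike.coe_injective
    ((U t : H →L[ℂ] H).continuous.ext_on hU.dense_domain (V t : H →L[ℂ] H).continuous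
      (eq_on_domain t)))

theorem unitaryExp_eq (hU : IsUnitaryGroupOf L U) : unitaryExp L = U 1 := by
  have hex : ∃ U : ℝ → unitary (H →L[ℂ] H), IsUnitaryGroupOf L U := ⟨U, hU⟩
  rw [unitaryExp, dif_pos hex, hex.choose_spec.unique hU]

theorem smul (hU : IsUnitaryGroupOf L U) {c : ℝ} (hc : c ≠ 0) :
    IsUnitaryGroupOf ((c : ℂ) • L) (fun t => U (c * t)) where
  map_zero := by simp [hU.map_zero]
  map_add s t := by rw [mul_add, hU.map_add]
  continuous f := (hU.continuous f).comp (continuous_const_mul c)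
  generator f g := by
    have hc' : (c : ℂ) ≠ 0 := Complex.ofReal_ne_zero.2 hc
    have mem_smul_graph : (f, g) ∈ ((c : ℂ) • L).graph ↔ (f, c⁻¹ • g) ∈ L.graph := by
      simp only [LinearPMap.mem_graph_iff, LinearPMap.smul_apply, ← Complex.coe_smul c⁻¹,
        Complex.ofReal_inv, eq_inv_smul_iff₀ hc', LinearPMap.smul_domain]
    have rescale {W : ℝ → H} {w : H} (d : ℝ) (h : HasDerivAt W w 0) :
        HasDerivAt (fun t => W (d * t)) (d • w) 0 := by
      have h' : HasDerivAt W w (d * 0) := by rwa [mul_zero]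
      simpa [Function.comp_def] using h'.scomp 0 ((hasDerivAt_id (0 : ℝ)).const_mul d)
    rw [mem_smul_graph, hU.generator]
    exact ⟨fun h => by simpa [hc] using rescale c h,
      fun h => by simpa [hc, ← mul_assoc] using rescale c⁻¹ h⟩

theorem apply_mem_graph_of_le (hU : IsUnitaryGroupOf L U) (hTL : T ≤ L)
    (h_inv : ∀ t, ∀ f ∈ T.domain, (U t : H →L[ℂ] H) f ∈ T.domain) {f g : H}
    (hfg : (f, g) ∈ T.graph) (t : ℝ) :
    ((U t : H →L[ℂ] H) f, (U t : H →L[ℂ] H) g) ∈ T.graph := by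
  have hL := hU.apply_mem_graph (LinearPMap.le_graph_of_le hTL hfg) t
  obtain ⟨g', hg'⟩ := LinearPMap.mem_domain_iff.1
    (h_inv t f (LinearPMap.mem_domain_of_mem_graph hfg))
  have h_eq : (U t : H →L[ℂ] H) g = g' :=
    LinearPMap.mem_graph_snd_inj' L hL (LinearPMap.le_graph_of_le hTL hg') rfl
  rwa [h_eq]

theorem apply_eq_of_inner_eq_zero (hU : IsUnitaryGroupOf L U) (hTL : T ≤ L)
    (h_inv : ∀ t, ∀ f ∈ T.domain, (U t : H →L[ℂ] H) f ∈ T.domain)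
    (hd : Dense (T.domain : Set H)) {f : H} (hf : ∀ p ∈ T.graph, inner ℂ f p.2 = 0) (t : ℝ) :
    (U t : H →L[ℂ] H) f = f := by
  refine hd.eq_of_inner_left ℂ fun ψ hψ => ?_
  obtain ⟨χ, hψχ⟩ := LinearPMap.mem_domain_iff.1 hψ
  have deriv_zero : ∀ s, HasDerivAt (fun s => inner ℂ f ((U s : H →L[ℂ] H) ψ)) 0 s := fun s => by
    simpa [hf _ (hU.apply_mem_graph_of_le hTL h_inv hψχ s)] using
      (hasDerivAt_const s f).inner ℂ (hU.hasDerivAt (LinearPMap.le_graph_of_le hTL hψχ) s)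
  calc inner ℂ ((U t : H →L[ℂ] H) f) ψ
      = inner ℂ ((U t : H →L[ℂ] H) f) ((U t : H →L[ℂ] H) ((U (-t) : H →L[ℂ] H) ψ)) := by
        rw [← hU.add_apply, add_neg_cancel, hU.zero_apply]
    _ = inner ℂ f ((U (-t) : H →L[ℂ] H) ψ) := Unitary.inner_map_map _ _ _
    _ = inner ℂ f ψ := by
        simpa [hU.zero_apply] using is_const_of_deriv_eq_zero
          (fun s => (deriv_zero s).differentiableAt) (fun s => (deriv_zero s).deriv) (-t) 0

theorem dense_map_one_sub (hU : IsUnitaryGroupOf L U) (hTL : T ≤ L)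
    (h_inv : ∀ t, ∀ f ∈ T.domain, (U t : H →L[ℂ] H) f ∈ T.domain)
    (hd : Dense (T.domain : Set H)) :
    Dense (T.graph.map (LinearMap.fst ℂ H H - LinearMap.snd ℂ H H) : Set H) := by
  rw [Submodule.dense_iff_topologicalClosure_eq_top, Submodule.topologicalClosure_eq_top_iff,
    Submodule.eq_bot_iff]
  intro f hf
  have inner_eq : ∀ p ∈ T.graph, inner ℂ f p.2 = inner ℂ f p.1 := fun p hp => by
    have := Submodule.inner_left_of_mem_orthogonal (Submodule.mem_map_of_mem hp) hf
    simpa [inner_sub_right, sub_eq_zero, eq_comm] using this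
  refine hd.eq_zero_of_inner_left ℂ fun ψ hψ => ?_
  obtain ⟨χ, hψχ⟩ := LinearPMap.mem_domain_iff.1 hψ
  have deriv_self : ∀ s, HasDerivAt (fun s => inner ℂ f ((U s : H →L[ℂ] H) ψ))
      (inner ℂ f ((U s : H →L[ℂ] H) ψ)) s := fun s => by
    simpa [inner_eq _ (hU.apply_mem_graph_of_le hTL h_inv hψχ s)] using
      (hasDerivAt_const s f).inner ℂ (hU.hasDerivAt (LinearPMap.le_graph_of_le hTL hψχ) s)
  simpa [hU.zero_apply] using eq_zero_of_hasDerivAt_self_of_norm_le deriv_self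
    (fun s => (norm_inner_le_norm _ _).trans_eq (by rw [Unitary.norm_map]))

theorem graph_le_topologicalClosure (hU : IsUnitaryGroupOf L U) (hTL : T ≤ L)
    (h_inv : ∀ t, ∀ f ∈ T.domain, (U t : H →L[ℂ] H) f ∈ T.domain)
    (hd : Dense (T.domain : Set H)) : L.graph ≤ T.graph.topologicalClosure := by
  rintro ⟨f, g⟩ hfg
  refine Metric.mem_closure_iff.2 fun ε hε => ?_
  obtain ⟨_, ⟨⟨φ, ψ⟩, hφψ, rfl⟩, hdist⟩ :=
    (hU.dense_map_one_sub hTL h_inv hd).exists_dist_lt (f - g) (half_pos hε)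
  have resolvent : ‖f - φ‖ ≤ ‖(f - φ) - (g - ψ)‖ :=
    hU.norm_le_norm_sub (L.graph.sub_mem hfg (LinearPMap.le_graph_of_le hTL hφψ))
  have triangle : ‖g - ψ‖ ≤ ‖f - φ‖ + ‖(f - φ) - (g - ψ)‖ := by
    simpa using norm_sub_le (f - φ) ((f - φ) - (g - ψ))
  have hlt : ‖(f - φ) - (g - ψ)‖ < ε / 2 := by
    rwa [sub_sub_sub_comm, ← dist_eq_norm]
  refine ⟨(φ, ψ), hφψ, ?_⟩
  rw [Prod.dist_eq, max_lt_iff, dist_eq_norm, dist_eq_norm]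
  constructor <;> linarith

theorem closure_of_le (hU : IsUnitaryGroupOf L U) (hTL : T ≤ L)
    (h_inv : ∀ t, ∀ f ∈ T.domain, (U t : H →L[ℂ] H) f ∈ T.domain)
    (hd : Dense (T.domain : Set H)) : IsUnitaryGroupOf T.closure U := by
  have closure_eq : T.closure = L := by
    refine LinearPMap.eq_of_eq_graph ?_
    rw [← (hU.isClosed.isClosable.leIsClosable hTL).graph_closure_eq_closure_graph]
    exact le_antisymm
      (Submodule.topologicalClosure_minimal _ (LinearPMap.le_graph_of_le hTL) hU.isClosed)
      (hU.graph_le_topologicalClosure hTL h_inv hd)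
  rwa [closure_eq]

theorem inner_eq_zero_of_apply_eq (hU : IsUnitaryGroupOf L U) {f : H}
    (hf : ∀ t, (U t : H →L[ℂ] H) f = f) {p : H × H} (hp : p ∈ L.graph) : inner ℂ f p.2 = 0 := by
  have mem_graph_zero : (f, 0) ∈ L.graph := by
    rw [hU.generator]
    simpa only [hf] using hasDerivAt_const (0 : ℝ) f
  simpa using hU.inner_add_inner_eq_zero mem_graph_zero hp

theorem mem_graph_adjoint_zero_iff (hU : IsUnitaryGroupOf L U) {f : H} :
    (f, 0) ∈ L.adjoint.graph ↔ ∀ t, (U t : H →L[ℂ] H) f = f := by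
  rw [LinearPMap.adjoint_graph_eq_graph_adjoint hU.dense_domain, Submodule.mem_adjoint_iff]
  constructor
  · intro hf
    refine hU.apply_eq_of_inner_eq_zero le_rfl (fun t g hg => ?_) hU.dense_domain fun p hp => ?_
    · obtain ⟨g', hgg'⟩ := LinearPMap.mem_domain_iff.1 hg
      exact LinearPMap.mem_domain_of_mem_graph (hU.apply_mem_graph hgg' t)
    · exact inner_eq_zero_symm.1 (by simpa using hf p.1 p.2 hp)
  · intro hf a b hab
    simpa using inner_eq_zero_symm.1 (hU.inner_eq_zero_of_apply_eq hf hab)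

end IsUnitaryGroupOf

end UnitaryGroups

/-! ### Graphs of sums and products of unbounded operators -/

section PartialMaps

variable {R E F : Type*} [Ring R] [AddCommGroup E] [Module R E] [AddCommGroup F] [Module R F]

theorem mem_graph_add {S T : E →ₗ.[R] F} {x : E} {g h : F} (hS : (x, g) ∈ S.graph)
    (hT : (x, h) ∈ T.graph) : (x, g + h) ∈ (S + T).graph := by
  obtain ⟨⟨_, hxS⟩, rfl, rfl⟩ := (LinearPMap.mem_graph_iff _).1 hS
  obtain ⟨⟨x, hxT⟩, rfl, rfl⟩ := (LinearPMap.mem_graph_iff _).1 hT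
  exact LinearPMap.mem_graph (S + T) ⟨x, hxS, hxT⟩

theorem mem_graph_sub {S T : E →ₗ.[R] F} {x : E} {g h : F} (hS : (x, g) ∈ S.graph)
    (hT : (x, h) ∈ T.graph) : (x, g - h) ∈ (S - T).graph := by
  obtain ⟨⟨_, hxS⟩, rfl, rfl⟩ := (LinearPMap.mem_graph_iff _).1 hS
  obtain ⟨⟨x, hxT⟩, rfl, rfl⟩ := (LinearPMap.mem_graph_iff _).1 hT
  exact LinearPMap.mem_graph (S - T) ⟨x, hxS, hxT⟩

theorem domain_sum {κ : Type*} (s : Finset κ) (T : κ → E →ₗ.[R] F) :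
    (∑ k ∈ s, T k).domain = ⨅ k ∈ s, (T k).domain := by
  classical
  induction s using Finset.induction_on with
  | empty => simp
  | insert a s ha ih => rw [Finset.sum_insert ha, LinearPMap.add_domain, ih, Finset.iInf_insert]

theorem mem_graph_sum {κ : Type*} {s : Finset κ} {T : κ → E →ₗ.[R] F} {f : E} {g : κ → F}
    (h : ∀ k ∈ s, (f, g k) ∈ (T k).graph) : (f, ∑ k ∈ s, g k) ∈ (∑ k ∈ s, T k).graph := by
  classical
  induction s using Finset.induction_on with
  | empty => exact LinearPMap.mem_graph (0 : E →ₗ.[R] F) ⟨f, trivial⟩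
  | insert a s ha ih =>
    rw [Finset.sum_insert ha, Finset.sum_insert ha]
    exact mem_graph_add (h a (s.mem_insert_self a))
      (ih fun k hk => h k (Finset.mem_insert_of_mem hk))

theorem mem_graph_sum_iff {κ : Type*} [Fintype κ] {T : κ → E →ₗ.[R] F} {f : E} {g : F} :
    (f, g) ∈ (∑ k, T k).graph ↔ ∃ h : κ → F, (∀ k, (f, h k) ∈ (T k).graph) ∧ ∑ k, h k = g := by
  constructor
  · intro hfg
    have hf := LinearPMap.mem_domain_of_mem_graph hfg
    simp only [domain_sum, Submodule.mem_iInf] at hf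
    have hT (k) : (f, T k ⟨f, hf k (Finset.mem_univ k)⟩) ∈ (T k).graph :=
      LinearPMap.mem_graph (T k) ⟨f, _⟩
    exact ⟨_, hT, LinearPMap.mem_graph_snd_inj _ (mem_graph_sum fun k _ => hT k) hfg rfl⟩
  · rintro ⟨h, hT, rfl⟩
    exact mem_graph_sum fun k _ => hT k

end PartialMaps

section SumConjSq

variable {H : Type*} [NormedAddCommGroup H] [InnerProductSpace ℂ H]

theorem mem_graph_opComp_iff {S T : H →ₗ.[ℂ] H} {f h : H} :
    (f, h) ∈ (opComp S T).graph ↔ ∃ g, (f, g) ∈ T.graph ∧ (g, h) ∈ S.graph := by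
  constructor
  · intro hfh
    obtain ⟨⟨f, hf⟩, rfl, rfl⟩ := (LinearPMap.mem_graph_iff _).1 hfh
    obtain ⟨hT, hS⟩ := (mem_opComp_domain S T f).1 hf
    exact ⟨T ⟨f, hT⟩, LinearPMap.mem_graph T ⟨f, hT⟩, LinearPMap.mem_graph S ⟨_, hS⟩⟩
  · rintro ⟨g, hT, hS⟩
    obtain ⟨⟨f, hf⟩, rfl, rfl⟩ := (LinearPMap.mem_graph_iff _).1 hT
    obtain ⟨⟨_, hg⟩, rfl : _ = T ⟨f, hf⟩, rfl⟩ := (LinearPMap.mem_graph_iff _).1 hS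
    exact LinearPMap.mem_graph (opComp S T) ⟨f, (mem_opComp_domain S T f).2 ⟨hf, hg⟩⟩

theorem mem_graph_ofBounded_iff {B : H →L[ℂ] H} {f g : H} :
    (f, g) ∈ (ofBounded B).graph ↔ B f = g := by
  simp [ofBounded]

variable [CompleteSpace H] {κ : Type*} [Fintype κ] {B : H →L[ℂ] H} {V : κ → H →ₗ.[ℂ] H} {f : H}

/-- The positive operator `∑ₖ B^* Vₖ Vₖ^* B` on its natural domain; `T_inv` is the case `B = R`,
`Vₖ = v_{k,n}`. -/
def sumConjSq (B : H →L[ℂ] H) (V : κ → H →ₗ.[ℂ] H) : H →ₗ.[ℂ] H :=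
  ∑ k, opComp (ofBounded (star B)) (opComp (V k) (opComp (V k).adjoint (ofBounded B)))

theorem mem_graph_sumConjSq_iff {g : H} :
    (f, g) ∈ (sumConjSq B V).graph ↔ ∃ h : κ → H,
      (∀ k, ∃ w u, (B f, u) ∈ (V k).adjoint.graph ∧ (u, w) ∈ (V k).graph ∧ star B w = h k) ∧
        ∑ k, h k = g := by
  simp only [sumConjSq, mem_graph_sum_iff, mem_graph_opComp_iff, mem_graph_ofBounded_iff,
    exists_eq_left', ← exists_and_right, and_assoc]

theorem inner_eq_norm_sq_of_mem_graph_adjoint {T : H →ₗ.[ℂ] H} (hT : Dense (T.domain : Set H))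
    {u w : H} (hu : (f, u) ∈ T.adjoint.graph) (hw : (u, w) ∈ T.graph) :
    inner ℂ f w = (‖u‖ : ℂ) ^ 2 := by
  rw [LinearPMap.adjoint_graph_eq_graph_adjoint hT, Submodule.mem_adjoint_iff] at hu
  rw [← inner_conj_symm, sub_eq_zero.1 (hu _ _ hw), inner_conj_symm]
  exact inner_self_eq_norm_sq_to_K u

theorem mem_graph_adjoint_zero_of_re_inner_nonpos (hV : ∀ k, Dense ((V k).domain : Set H)) {g : H}
    (hfg : (f, g) ∈ (sumConjSq B V).graph) (hle : (inner ℂ f g).re ≤ 0) (k : κ) :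
    (B f, 0) ∈ (V k).adjoint.graph := by
  obtain ⟨h, hh, rfl⟩ := mem_graph_sumConjSq_iff.1 hfg
  choose w u hu hw hwh using hh
  have inner_eq (k) : (inner ℂ f (h k)).re = ‖u k‖ ^ 2 := by
    rw [← hwh, ContinuousLinearMap.star_eq_adjoint, ContinuousLinearMap.adjoint_inner_right,
      inner_eq_norm_sq_of_mem_graph_adjoint (hV k) (hu k) (hw k), ← Complex.ofReal_pow,
      Complex.ofReal_re]
  rw [inner_sum, Complex.re_sum, Finset.sum_congr rfl fun k _ => inner_eq k] at hle
  have u_eq_zero : u k = 0 := by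
    have sum_eq_zero := hle.antisymm (Finset.sum_nonneg fun k _ => sq_nonneg ‖u k‖)
    simpa using (Finset.sum_eq_zero_iff_of_nonneg fun k _ => sq_nonneg ‖u k‖).1 sum_eq_zero k
  exact u_eq_zero ▸ hu k

theorem mem_graph_sumConjSq_zero (h : ∀ k, (B f, 0) ∈ (V k).adjoint.graph) :
    (f, 0) ∈ (sumConjSq B V).graph :=
  mem_graph_sumConjSq_iff.2
    ⟨0, fun k => ⟨0, 0, h k, (V k).graph.zero_mem, map_zero _⟩, Finset.sum_const_zero⟩

end SumConjSq

/-! ### Schwartz functions along a flow of isometries -/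

section Flows

variable {E : Type*} [NormedAddCommGroup E] [InnerProductSpace ℝ E] {D : E →L[ℝ] E}
  {V : ℝ → E ≃ₗᵢ[ℝ] E}

/-- The derivative of a Schwartz function along the linear vector field `X ↦ D X`. -/
def linearFieldDeriv : (E →L[ℝ] E) →ₗ[ℝ] 𝓢(E, ℂ) →ₗ[ℂ] 𝓢(E, ℂ) :=
  LinearMap.mk₂' ℝ ℂ
    (fun D φ => bilinLeftCLM (ContinuousLinearMap.apply ℝ ℂ (E := E)).flip
      (ContinuousLinearMap.hasTemperateGrowth D) (fderivCLM ℂ E ℂ φ))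
    (fun D D' φ => by ext X; simp [bilinLeftCLM_apply])
    (fun c D φ => by ext X; simp [bilinLeftCLM_apply])
    (fun D φ ψ => by simp)
    (fun D c φ => by ext X; simp [bilinLeftCLM_apply])

theorem linearFieldDeriv_apply (D : E →L[ℝ] E) (φ : 𝓢(E, ℂ)) (X : E) :
    linearFieldDeriv D φ X = fderiv ℝ φ X (D X) := rfl

theorem linearFieldDeriv_apply_linearFieldDeriv (A B : E →L[ℝ] E) (φ : 𝓢(E, ℂ)) (X : E) :
    linearFieldDeriv A (linearFieldDeriv B φ) X =
      fderiv ℝ (fderiv ℝ φ) X (A X) (B X) + fderiv ℝ φ X (B (A X)) := by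
  have hasFDerivAt_fderiv : HasFDerivAt (fderiv ℝ φ) (fderiv ℝ (fderiv ℝ φ) X) X :=
    (((φ.smooth 2).fderiv_right (m := 1) (by norm_num)).differentiable (by norm_num) X).hasFDerivAt
  have hasFDerivAt_field : HasFDerivAt (linearFieldDeriv B φ) _ X :=
    hasFDerivAt_fderiv.clm_apply B.hasFDerivAt
  rw [linearFieldDeriv_apply, hasFDerivAt_field.fderiv]
  simp [add_comm]

theorem linearFieldDeriv_commutator (A B : E →L[ℝ] E) (φ : 𝓢(E, ℂ)) :
    linearFieldDeriv A (linearFieldDeriv B φ) - linearFieldDeriv B (linearFieldDeriv A φ) =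
      linearFieldDeriv (B ∘L A - A ∘L B) φ := by
  ext X
  have h_symm : IsSymmSndFDerivAt ℝ φ X := (φ.smooth 2).contDiffAt.isSymmSndFDerivAt (by simp)
  rw [_root_.sub_apply, linearFieldDeriv_apply_linearFieldDeriv,
    linearFieldDeriv_apply_linearFieldDeriv, h_symm.eq (B X) (A X), linearFieldDeriv_apply]
  simp

/-- `V` is a one-parameter group of linear isometries whose infinitesimal generator is `D`. -/
structure IsIsometricFlow (D : E →L[ℝ] E) (V : ℝ → E ≃ₗᵢ[ℝ] E) : Prop where
  map_zero : ∀ X, V 0 X = X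
  map_add : ∀ s t X, V (s + t) X = V s (V t X)
  hasDerivAt : ∀ X t, HasDerivAt (fun t => V t X) (D (V t X)) t

namespace IsIsometricFlow

theorem continuous_uncurry (hV : IsIsometricFlow D V) : Continuous fun p : ℝ × E => V p.1 p.2 :=
  continuous_prod_of_continuous_lipschitzWith' _ 1 (fun t => (V t).lipschitz)
    fun X => continuous_iff_continuousAt.2 fun t => (hV.hasDerivAt X t).continuousAt

theorem hasDerivAt_comp (hV : IsIsometricFlow D V) (φ : 𝓢(E, ℂ)) (X : E) (t : ℝ) :
    HasDerivAt (fun t => φ (V t X)) (linearFieldDeriv D φ (V t X)) t :=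
  (φ.hasFDerivAt (V t X)).comp_hasDerivAt t (hV.hasDerivAt X t)

theorem norm_comp_sub_le (hV : IsIsometricFlow D V) (φ : 𝓢(E, ℂ)) {w : ℝ → ℝ}
    (hw : ∀ X, ‖linearFieldDeriv D φ X‖ ≤ w ‖X‖) (X : E) (t : ℝ) :
    ‖φ (V t X) - φ X‖ ≤ w ‖X‖ * |t| := by
  simpa [hV.map_zero] using convex_univ.norm_image_sub_le_of_norm_hasDerivWithin_le
    (C := w ‖X‖) (x := 0) (y := t) (fun s _ => (hV.hasDerivAt_comp φ X s).hasDerivWithinAt)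
    (fun s _ => (hw _).trans_eq (by rw [LinearIsometryEquiv.norm_map])) trivial trivial

theorem norm_comp_sub_sub_le (hV : IsIsometricFlow D V) (φ : 𝓢(E, ℂ)) {w : ℝ → ℝ}
    (hw : ∀ X, ‖linearFieldDeriv D (linearFieldDeriv D φ) X‖ ≤ w ‖X‖) (X : E) (t : ℝ) :
    ‖φ (V t X) - φ X - t • linearFieldDeriv D φ X‖ ≤ w ‖X‖ * |t| ^ 2 := by
  set ψ := linearFieldDeriv D φ
  have w_nonneg : 0 ≤ w ‖X‖ := (norm_nonneg _).trans (hw X)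
  have hasDerivAt_remainder (s : ℝ) :
      HasDerivAt (fun t => φ (V t X) - t • ψ X) (ψ (V s X) - ψ X) s := by
    simpa using (hV.hasDerivAt_comp φ X s).fun_sub ((hasDerivAt_id s).smul_const (ψ X))
  have taylor := (convex_closedBall (0 : ℝ) |t|).norm_image_sub_le_of_norm_hasDerivWithin_le
    (C := w ‖X‖ * |t|) (x := 0) (y := t) (fun s _ => (hasDerivAt_remainder s).hasDerivWithinAt)
    (fun s hs => (hV.norm_comp_sub_le ψ hw X s).trans
      (mul_le_mul_of_nonneg_left (mem_closedBall_zero_iff.1 hs) w_nonneg)) (by simp) (by simp)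
  rw [sub_right_comm]
  simpa [hV.map_zero, pow_two, mul_assoc] using taylor

end IsIsometricFlow

variable [FiniteDimensional ℝ E] [MeasurableSpace E] [BorelSpace E]

/-- A linear operator on Schwartz functions, regarded as an unbounded operator of `L²`. -/
def schwartzOperator (A : 𝓢(E, ℂ) →ₗ[ℂ] 𝓢(E, ℂ)) :
    Lp ℂ 2 (volume : Measure E) →ₗ.[ℂ] Lp ℂ 2 (volume : Measure E) where
  domain := LinearMap.range (toLpCLM ℂ ℂ 2 (volume : Measure E)).toLinearMap
  toFun := (toLpCLM ℂ ℂ 2 (volume : Measure E)).toLinearMap ∘ₗ A ∘ₗ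
    (LinearEquiv.ofInjective (toLpCLM ℂ ℂ 2 (volume : Measure E)).toLinearMap
      (injective_toLp 2 (volume : Measure E))).symm.toLinearMap

theorem schwartzOperator_apply (A : 𝓢(E, ℂ) →ₗ[ℂ] 𝓢(E, ℂ)) (φ : 𝓢(E, ℂ)) :
    schwartzOperator A ⟨φ.toLp 2, φ, rfl⟩ = (A φ).toLp 2 := by
  have h_symm : (LinearEquiv.ofInjective (toLpCLM ℂ ℂ 2 (volume : Measure E)).toLinearMap
      (injective_toLp 2 (volume : Measure E))).symm ⟨φ.toLp 2, φ, rfl⟩ = φ :=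
    (LinearEquiv.symm_apply_eq _).2 rfl
  exact congrArg (fun ψ => (A ψ).toLp 2) h_symm

theorem mem_graph_schwartzOperator {A : 𝓢(E, ℂ) →ₗ[ℂ] 𝓢(E, ℂ)}
    {f g : Lp ℂ 2 (volume : Measure E)} :
    (f, g) ∈ (schwartzOperator A).graph ↔ ∃ φ : 𝓢(E, ℂ), φ.toLp 2 = f ∧ (A φ).toLp 2 = g := by
  rw [LinearPMap.mem_graph_iff]
  constructor
  · rintro ⟨⟨_, φ, rfl⟩, rfl, rfl⟩
    exact ⟨φ, rfl, (schwartzOperator_apply A φ).symm⟩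
  · rintro ⟨φ, rfl, rfl⟩
    exact ⟨⟨_, φ, rfl⟩, rfl, schwartzOperator_apply A φ⟩

theorem dense_domain_schwartzOperator (A : 𝓢(E, ℂ) →ₗ[ℂ] 𝓢(E, ℂ)) :
    Dense ((schwartzOperator A).domain : Set (Lp ℂ 2 (volume : Measure E))) :=
  denseRange_toLpCLM (by norm_num)

theorem mem_graph_adjoint_schwartzOperator {A B : 𝓢(E, ℂ) →ₗ[ℂ] 𝓢(E, ℂ)}
    (h : ∀ φ ψ : 𝓢(E, ℂ),
      inner ℂ ((B φ).toLp 2) (ψ.toLp 2) = inner ℂ (φ.toLp 2) ((A ψ).toLp 2))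
    (φ : 𝓢(E, ℂ)) :
    (φ.toLp 2 volume, (B φ).toLp 2 volume) ∈ (schwartzOperator A).adjoint.graph := by
  rw [LinearPMap.adjoint_graph_eq_graph_adjoint (dense_domain_schwartzOperator A),
    Submodule.mem_adjoint_iff]
  intro f g hfg
  obtain ⟨ψ, rfl, rfl⟩ := mem_graph_schwartzOperator.1 hfg
  rw [← inner_conj_symm, ← h, inner_conj_symm, sub_self]

/-- The composition with a linear isometry, as a unitary operator of `L²`. -/
def compUnitary (e : E ≃ₗᵢ[ℝ] E) :
    unitary (Lp ℂ 2 (volume : Measure E) →L[ℂ] Lp ℂ 2 (volume : Measure E)) :=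
  Unitary.linearIsometryEquiv.symm
    (LinearIsometryEquiv.ofSurjective (Lp.compMeasurePreservingₗᵢ ℂ e e.measurePreserving)
      fun f => ⟨Lp.compMeasurePreserving e.symm e.symm.measurePreserving f, by
        change Lp.compMeasurePreserving _ _ (Lp.compMeasurePreserving _ _ f) = f
        rw [← Lp.compMeasurePreserving_comp_apply]
        convert! Lp.compMeasurePreserving_id_apply f
        ext; simp⟩)

theorem compUnitary_apply (e : E ≃ₗᵢ[ℝ] E) (f : Lp ℂ 2 (volume : Measure E)) :
    (compUnitary e : Lp ℂ 2 (volume : Measure E) →L[ℂ] Lp ℂ 2 (volume : Measure E)) f =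
      Lp.compMeasurePreserving e e.measurePreserving f := rfl

theorem compUnitary_apply_eq_self_iff (e : E ≃ₗᵢ[ℝ] E) (f : Lp ℂ 2 (volume : Measure E)) :
    (compUnitary e : Lp ℂ 2 (volume : Measure E) →L[ℂ] Lp ℂ 2 (volume : Measure E)) f = f ↔
      ∀ᵐ X, f X = f (e X) := by
  rw [compUnitary_apply, Lp.ext_iff]
  refine Filter.eventually_congr ?_
  filter_upwards [Lp.coeFn_compMeasurePreserving f e.measurePreserving] with X hX
  rw [hX, Function.comp_apply, eq_comm]

theorem compUnitary_toLp (e : E ≃ₗᵢ[ℝ] E) (φ : 𝓢(E, ℂ)) :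
    (compUnitary e : Lp ℂ 2 (volume : Measure E) →L[ℂ] Lp ℂ 2 (volume : Measure E)) (φ.toLp 2) =
      (compCLMOfContinuousLinearEquiv ℂ e.toContinuousLinearEquiv φ).toLp 2 := by
  rw [compUnitary_apply, SchwartzMap.toLp, Lp.toLp_compMeasurePreserving]
  rfl

theorem compUnitary_apply_mem_domain_schwartzOperator (e : E ≃ₗᵢ[ℝ] E)
    (A : 𝓢(E, ℂ) →ₗ[ℂ] 𝓢(E, ℂ)) {f : Lp ℂ 2 (volume : Measure E)}
    (hf : f ∈ (schwartzOperator A).domain) :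
    (compUnitary e : Lp ℂ 2 (volume : Measure E) →L[ℂ] Lp ℂ 2 (volume : Measure E)) f ∈
      (schwartzOperator A).domain := by
  obtain ⟨φ, rfl⟩ := hf
  exact ⟨_, (compUnitary_toLp e φ).symm⟩

theorem exists_memLp_two_norm_le_comp_norm (φ : 𝓢(E, ℂ)) :
    ∃ w : ℝ → ℝ, MemLp (fun X : E => w ‖X‖) 2 ∧ ∀ X, ‖φ X‖ ≤ w ‖X‖ := by
  set k : ℕ := Module.finrank ℝ E + 1 with hk
  obtain ⟨C, hC⟩ : ∃ C, ∀ X, (1 + ‖X‖) ^ k * ‖φ X‖ ≤ C :=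
    ⟨_, fun X => by
      simpa using one_add_le_sup_seminorm_apply (𝕜 := ℝ) (m := (k, 0)) le_rfl le_rfl φ X⟩
  refine ⟨fun r => C * (1 + r) ^ (-(k : ℝ)), MemLp.const_mul ?_ C, fun X => ?_⟩
  · have h_cont : Continuous fun X : E => (1 + ‖X‖) ^ (-(k : ℝ)) :=
      (continuous_const.add continuous_norm).rpow_const
        fun X => Or.inl (by positivity : 1 + ‖X‖ ≠ 0)
    have sq_eq (X : E) : ((1 + ‖X‖) ^ (-(k : ℝ))) ^ 2 = (1 + ‖X‖) ^ (-(2 * k : ℝ)) := by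
      rw [← Real.rpow_natCast, ← Real.rpow_mul (by positivity)]
      congr 1; push_cast; ring
    rw [memLp_two_iff_integrable_sq h_cont.aestronglyMeasurable]
    simp only [sq_eq]
    refine integrable_one_add_norm ?_
    rw [hk]; push_cast
    linarith [(Nat.cast_nonneg (Module.finrank ℝ E) : (0 : ℝ) ≤ _)]
  · beta_reduce
    rw [Real.rpow_neg (by positivity), Real.rpow_natCast, ← div_eq_mul_inv,
      le_div_iff₀ (by positivity), mul_comm]
    exact hC X

namespace IsIsometricFlow

theorem isUnitaryGroupOf_generator (hV : IsIsometricFlow D V) :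
    IsUnitaryGroupOf (unitaryGroupGenerator fun t => compUnitary (V t))
      (fun t => compUnitary (V t)) := by
  refine isUnitaryGroupOf_unitaryGroupGenerator ?_ (fun s t => ?_) (fun f => ?_)
  · refine Subtype.ext (ContinuousLinearMap.ext fun f =>
      (compUnitary_apply_eq_self_iff (V 0) f).2 ?_)
    simp [hV.map_zero]
  · refine Subtype.ext (ContinuousLinearMap.ext fun f => ?_)
    change Lp.compMeasurePreserving _ _ f =
      Lp.compMeasurePreserving _ _ (Lp.compMeasurePreserving _ _ f)
    have coe_add : ⇑(V (s + t)) = V t ∘ V s := by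
      ext X
      rw [add_comm, hV.map_add, Function.comp_apply]
    rw [← Lp.compMeasurePreserving_comp_apply]
    simp only [coe_add]
  · exact (continuous_const (y := f)).compMeasurePreservingLp
      (g := fun t => (⟨V t, (V t).continuous⟩ : C(E, E)))
      (ContinuousMap.continuous_of_continuous_uncurry _ hV.continuous_uncurry)
      (fun t => (V t).measurePreserving) (by norm_num)

theorem norm_compUnitary_sub_sub_le (hV : IsIsometricFlow D V) (φ : 𝓢(E, ℂ)) :
    ∃ C, ∀ t, ‖(compCLMOfContinuousLinearEquiv ℂ (V t).toContinuousLinearEquiv φ).toLp 2 volume -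
      φ.toLp 2 volume - t • (linearFieldDeriv D φ).toLp 2 volume‖ ≤ |t| ^ 2 * C := by
  obtain ⟨w, hw, h_bound⟩ :=
    exists_memLp_two_norm_le_comp_norm (linearFieldDeriv D (linearFieldDeriv D φ))
  refine ⟨‖hw.toLp‖, fun t => ?_⟩
  set φt := compCLMOfContinuousLinearEquiv ℂ (V t).toContinuousLinearEquiv φ
  have toLp_eq : φt.toLp 2 volume - φ.toLp 2 volume - t • (linearFieldDeriv D φ).toLp 2 volume =
      (φt - φ - t • linearFieldDeriv D φ).toLp 2 volume := by
    simp only [← toLpCLM_apply (𝕜 := ℝ), map_sub, map_smul]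
  rw [toLp_eq]
  refine Lp.norm_le_mul_norm_of_ae_le_mul ?_
  filter_upwards [hw.coeFn_toLp, (φt - φ - t • linearFieldDeriv D φ).coeFn_toLp 2 volume]
    with X h_w h_diff
  rw [h_w, h_diff, mul_comm]
  exact (hV.norm_comp_sub_sub_le φ h_bound X t).trans
    (mul_le_mul_of_nonneg_right (le_abs_self _) (by positivity))

theorem toLp_mem_graph_generator (hV : IsIsometricFlow D V) (φ : 𝓢(E, ℂ)) :
    (φ.toLp 2 volume, (linearFieldDeriv D φ).toLp 2 volume) ∈
      (unitaryGroupGenerator fun t => compUnitary (V t)).graph := by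
  obtain ⟨C, hC⟩ := hV.norm_compUnitary_sub_sub_le φ
  refine mem_graph_unitaryGroupGenerator.2 (hasDerivAt_iff_isLittleO.2 ?_)
  refine Asymptotics.IsBigO.trans_isLittleO (g := fun t : ℝ => t ^ 2) ?_
    (by simpa using Asymptotics.isLittleO_pow_id (𝕜 := ℝ) (n := 2) (by norm_num))
  refine Asymptotics.IsBigO.of_bound C (Filter.Eventually.of_forall fun t => ?_)
  rw [hV.isUnitaryGroupOf_generator.zero_apply, compUnitary_toLp, sub_zero, norm_pow, mul_comm]
  exact hC t

theorem schwartzOperator_le_generator (hV : IsIsometricFlow D V) :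
    schwartzOperator (linearFieldDeriv D) ≤ unitaryGroupGenerator fun t => compUnitary (V t) := by
  refine LinearPMap.le_of_le_graph ?_
  rintro ⟨f, g⟩ hfg
  obtain ⟨φ, rfl, rfl⟩ := mem_graph_schwartzOperator.1 hfg
  exact hV.toLp_mem_graph_generator φ

theorem isUnitaryGroupOf_closure (hV : IsIsometricFlow D V) :
    IsUnitaryGroupOf (schwartzOperator (linearFieldDeriv D)).closure
      (fun t => compUnitary (V t)) :=
  hV.isUnitaryGroupOf_generator.closure_of_le hV.schwartzOperator_le_generator
    (fun t _ => compUnitary_apply_mem_domain_schwartzOperator (V t) _)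
    (dense_domain_schwartzOperator _)

theorem forall_compUnitary_apply_eq_iff (hV : IsIsometricFlow D V)
    {f : Lp ℂ 2 (volume : Measure E)} :
    (∀ t, (compUnitary (V t) :
        Lp ℂ 2 (volume : Measure E) →L[ℂ] Lp ℂ 2 (volume : Measure E)) f = f) ↔
      ∀ φ : 𝓢(E, ℂ), inner ℂ f ((linearFieldDeriv D φ).toLp 2) = 0 := by
  constructor
  · exact fun hf φ => hV.isUnitaryGroupOf_generator.inner_eq_zero_of_apply_eq hf
      (hV.toLp_mem_graph_generator φ)
  · refine fun hf => hV.isUnitaryGroupOf_generator.apply_eq_of_inner_eq_zero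
      hV.schwartzOperator_le_generator
      (fun t _ => compUnitary_apply_mem_domain_schwartzOperator (V t) _)
      (dense_domain_schwartzOperator _) ?_
    rintro ⟨f, g⟩ hfg
    obtain ⟨φ, rfl, rfl⟩ := mem_graph_schwartzOperator.1 hfg
    exact hf φ

end IsIsometricFlow

end Flows

/-! ### Antisymmetric matrices and the flows they generate -/

attribute [local instance] LieRing.ofAssociativeRing

section Antisymmetric

open LieAlgebra.Orthogonal

variable {ι R : Type*} [DecidableEq ι]

/-- The antisymmetric matrix of the infinitesimal rotation in the plane of the coordinates `j` and
`k`, with the entry `1` at `(k, j)`. The order is such that it corresponds to `v_{j,k}`. -/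
def rotationGenerator [Ring R] (j k : ι) : Matrix ι ι R :=
  Matrix.single k j 1 - Matrix.single j k 1

theorem transpose_rotationGenerator [Ring R] (j k : ι) :
    (rotationGenerator j k : Matrix ι ι R)ᵀ = -rotationGenerator j k := by
  simp [rotationGenerator, Matrix.transpose_sub]

theorem neg_rotationGenerator [Ring R] (j k : ι) :
    -(rotationGenerator j k : Matrix ι ι R) = rotationGenerator k j :=
  neg_sub _ _

variable [Fintype ι]

theorem rotationGenerator_mem_so [CommRing R] (j k : ι) :
    (rotationGenerator j k : Matrix ι ι R) ∈ so ι R :=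
  (mem_so ι R _).2 (transpose_rotationGenerator j k)

theorem lie_rotationGenerator [CommRing R] {j k l : ι} (hjk : j ≠ k) (hjl : j ≠ l) (hkl : k ≠ l) :
    ⁅(rotationGenerator j l : Matrix ι ι R), (rotationGenerator k l : Matrix ι ι R)⁆ =
      rotationGenerator j k := by
  simp only [Ring.lie_def, rotationGenerator, Matrix.mul_sub, Matrix.sub_mul, ne_eq, hjk, hjl, hkl,
    hjk.symm, hjl.symm, hkl.symm, not_false_eq_true, Matrix.single_mul_single_of_ne,
    Matrix.single_mul_single_same, mul_one, zero_sub, sub_self, sub_zero, sub_neg_eq_add]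
  abel

theorem eq_sum_rotationGenerator [Field R] [NeZero (2 : R)] {A : Matrix ι ι R} (hA : Aᵀ = -A) :
    A = ∑ p : ι × ι, (A p.2 p.1 / 2) • rotationGenerator p.1 p.2 := by
  ext a b
  have h_entry : A b a = -A a b := congrFun₂ hA a b
  simp only [rotationGenerator, Fintype.sum_prod_type, Matrix.sum_apply, Matrix.smul_apply,
    Matrix.sub_apply, Matrix.single_apply, ite_and, smul_eq_mul, mul_sub, mul_ite, mul_one,
    mul_zero, Finset.sum_sub_distrib, Finset.sum_ite_eq', Finset.sum_ite_irrel,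
    Finset.sum_const_zero, Finset.mem_univ, if_true, h_entry]
  field_simp
  ring

theorem lieSpan_range_rotationGenerator [Field R] [NeZero (2 : R)] (l : ι) :
    LieSubalgebra.lieSpan R (Matrix ι ι R) (Set.range fun k => rotationGenerator k l) =
      so ι R := by
  refine le_antisymm (LieSubalgebra.lieSpan_le.2 ?_) fun A hA => ?_
  · rintro _ ⟨k, rfl⟩
    exact rotationGenerator_mem_so k l
  set K := LieSubalgebra.lieSpan R (Matrix ι ι R) (Set.range fun k => rotationGenerator k l)
  have mem_of_eq_right (k : ι) : rotationGenerator k l ∈ K :=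
    LieSubalgebra.subset_lieSpan ⟨k, rfl⟩
  have mem (j k : ι) : (rotationGenerator j k : Matrix ι ι R) ∈ K := by
    rcases eq_or_ne k l with rfl | hkl
    · exact mem_of_eq_right j
    rcases eq_or_ne j l with rfl | hjl
    · exact neg_rotationGenerator (R := R) k j ▸ neg_mem (mem_of_eq_right k)
    rcases eq_or_ne j k with rfl | hjk
    · simp [rotationGenerator]
    · exact lie_rotationGenerator (R := R) hjk hjl hkl ▸
        K.lie_mem (mem_of_eq_right j) (mem_of_eq_right k)
  rw [eq_sum_rotationGenerator ((mem_so ι R A).1 hA)]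
  exact sum_mem fun p _ => K.smul_mem _ (mem p.1 p.2)

end Antisymmetric

section MatrixFlows

open LieAlgebra.Orthogonal

variable {m n : ℕ}

namespace MatSpace

theorem mulRight_apply (X : MatSpace m n) (B : Matrix (Fin n) (Fin n) ℝ) (i : Fin m) (j : Fin n) :
    X.mulRight B (i, j) = ∑ k, X (i, k) * B k j := by
  simp [mulRight, toMatrix, Matrix.mul_apply]

theorem toMatrix_mulRight (X : MatSpace m n) (B : Matrix (Fin n) (Fin n) ℝ) :
    (X.mulRight B).toMatrix = X.toMatrix * B := rfl

theorem toMatrix_injective : Function.Injective (toMatrix : MatSpace m n → _) := fun X Y h => by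
  ext ⟨i, j⟩
  exact congrFun₂ h i j

theorem mulRight_mul (X : MatSpace m n) (A B : Matrix (Fin n) (Fin n) ℝ) :
    X.mulRight (A * B) = (X.mulRight A).mulRight B :=
  toMatrix_injective (Matrix.mul_assoc X.toMatrix A B).symm

theorem mulRight_one (X : MatSpace m n) : X.mulRight 1 = X :=
  toMatrix_injective (Matrix.mul_one X.toMatrix)

theorem norm_sq_eq_trace (X : MatSpace m n) : ‖X‖ ^ 2 = (X.toMatrix * X.toMatrixᵀ).trace := by
  rw [EuclideanSpace.norm_sq_eq, Fintype.sum_prod_type]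
  simp [Matrix.trace, Matrix.mul_apply, toMatrix, pow_two]

theorem norm_mulRight {B : Matrix (Fin n) (Fin n) ℝ} (hB : B * Bᵀ = 1) (X : MatSpace m n) :
    ‖X.mulRight B‖ = ‖X‖ := by
  rw [← sq_eq_sq₀ (norm_nonneg _) (norm_nonneg _), norm_sq_eq_trace, norm_sq_eq_trace,
    toMatrix_mulRight, Matrix.transpose_mul, Matrix.mul_assoc, ← Matrix.mul_assoc B, hB,
    Matrix.one_mul]

/-- The right multiplication by a matrix, as a continuous linear map depending linearly on the
matrix. -/
def mulRightCLM (m : ℕ) {n : ℕ} :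
    Matrix (Fin n) (Fin n) ℝ →ₗ[ℝ] (MatSpace m n →L[ℝ] MatSpace m n) :=
  LinearMap.toContinuousLinearMap.toLinearMap ∘ₗ LinearMap.mk₂ ℝ (fun B X => X.mulRight B)
    (fun A B X => by ext ⟨i, j⟩; simp [mulRight_apply, mul_add, Finset.sum_add_distrib])
    (fun c B X => by ext ⟨i, j⟩; simp [mulRight_apply, mul_left_comm, Finset.mul_sum])
    (fun B X Y => by ext ⟨i, j⟩; simp [mulRight_apply, add_mul, Finset.sum_add_distrib])
    (fun c B X => by ext ⟨i, j⟩; simp [mulRight_apply, mul_assoc, Finset.mul_sum])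

theorem mulRightCLM_apply (B : Matrix (Fin n) (Fin n) ℝ) (X : MatSpace m n) :
    mulRightCLM m B X = X.mulRight B := rfl

theorem mulRightCLM_comp (A B : Matrix (Fin n) (Fin n) ℝ) :
    mulRightCLM m A ∘L mulRightCLM m B = mulRightCLM m (B * A) :=
  ContinuousLinearMap.ext fun X => (mulRight_mul X B A).symm

theorem mulRightCLM_lie (A B : Matrix (Fin n) (Fin n) ℝ) :
    mulRightCLM m ⁅A, B⁆ =
      mulRightCLM m B ∘L mulRightCLM m A - mulRightCLM m A ∘L mulRightCLM m B := by
  rw [Ring.lie_def, map_sub, mulRightCLM_comp, mulRightCLM_comp]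

theorem hasDerivAt_mulRight_exp (X : MatSpace m n) (A : Matrix (Fin n) (Fin n) ℝ) (t : ℝ) :
    HasDerivAt (fun t : ℝ => X.mulRight (NormedSpace.exp (t • A)))
      ((X.mulRight (NormedSpace.exp (t • A))).mulRight A) t := by
  let : NormedRing (Matrix (Fin n) (Fin n) ℝ) := Matrix.linftyOpNormedRing
  let : NormedAlgebra ℝ (Matrix (Fin n) (Fin n) ℝ) := Matrix.linftyOpNormedAlgebra
  let evalAt : Matrix (Fin n) (Fin n) ℝ →L[ℝ] MatSpace m n :=
    LinearMap.toContinuousLinearMap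
      ((ContinuousLinearMap.apply ℝ (MatSpace m n) X).toLinearMap ∘ₗ mulRightCLM m)
  rw [← mulRight_mul]
  exact evalAt.hasFDerivAt.comp_hasDerivAt t (hasDerivAt_exp_smul_const (𝕂 := ℝ) A t)

end MatSpace

theorem exp_mul_transpose_exp (A : so (Fin n) ℝ) :
    NormedSpace.exp (A : Matrix (Fin n) (Fin n) ℝ) * (NormedSpace.exp A.1)ᵀ = 1 := by
  rw [← Matrix.exp_transpose, (mem_so _ _ _).1 A.2,
    ← Matrix.exp_add_of_commute _ _ (Commute.refl A.1).neg_right, add_neg_cancel,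
    NormedSpace.exp_zero]

/-- The rotation `X ↦ X e^A` given by an antisymmetric matrix `A`. -/
def matRotation (m : ℕ) {n : ℕ} (A : so (Fin n) ℝ) : MatSpace m n ≃ₗᵢ[ℝ] MatSpace m n :=
  LinearIsometry.toLinearIsometryEquiv
    { toLinearMap := MatSpace.mulRightCLM m (NormedSpace.exp A.1)
      norm_map' := MatSpace.norm_mulRight (exp_mul_transpose_exp A) } rfl

theorem matRotation_apply (A : so (Fin n) ℝ) (X : MatSpace m n) :
    matRotation m A X = X.mulRight (NormedSpace.exp A.1) := rfl

theorem isIsometricFlow_matRotation (A : so (Fin n) ℝ) :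
    IsIsometricFlow (MatSpace.mulRightCLM m A.1) fun t => matRotation m (t • A) where
  map_zero X := by simp [matRotation_apply, MatSpace.mulRight_one]
  map_add s t X := by
    simp only [matRotation_apply, SetLike.val_smul, ← MatSpace.mulRight_mul]
    rw [add_comm, add_smul,
      Matrix.exp_add_of_commute _ _ (((Commute.refl A.1).smul_left t).smul_right s)]
  hasDerivAt X t := X.hasDerivAt_mulRight_exp A.1 t

theorem isMwRI_iff_compUnitary_apply_eq {f : HilbertMN m n} :
    IsMwRI f ↔ ∀ (A : so (Fin n) ℝ) (t : ℝ),
      (compUnitary (matRotation m (t • A)) : HilbertMN m n →L[ℂ] HilbertMN m n) f = f := by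
  simp only [compUnitary_apply_eq_self_iff, matRotation_apply]
  constructor
  · exact fun hf A t => hf _ ((mem_so _ _ _).1 (t • A).2)
  · intro hf A hA
    simpa using hf ⟨A, (mem_so _ _ _).2 hA⟩ 1

end MatrixFlows

/-! ### Position and derivative operators -/

section CanonicalCommutation

variable {ι : Type*} [Fintype ι]

/-- The multiplication by the coordinate `x_p`, on Schwartz functions. -/
def positionOp (p : ι) : 𝓢(EuclideanSpace ℝ ι, ℂ) →ₗ[ℂ] 𝓢(EuclideanSpace ℝ ι, ℂ) :=
  (smulLeftCLM ℂ fun X : EuclideanSpace ℝ ι => ((X p : ℝ) : ℂ)).toLinearMap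

theorem positionOp_apply (p : ι) (φ : 𝓢(EuclideanSpace ℝ ι, ℂ)) (X : EuclideanSpace ℝ ι) :
    positionOp p φ X = X p * φ X :=
  smulLeftCLM_apply_apply (Complex.ofRealCLM ∘L EuclideanSpace.proj p).hasTemperateGrowth φ X

theorem positionOp_comm (p q : ι) (φ : 𝓢(EuclideanSpace ℝ ι, ℂ)) :
    positionOp p (positionOp q φ) = positionOp q (positionOp p φ) := by
  ext X
  simp only [positionOp_apply, mul_left_comm]

theorem inner_positionOp_left (p : ι) (φ ψ : 𝓢(EuclideanSpace ℝ ι, ℂ)) :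
    inner ℂ ((positionOp p φ).toLp 2) (ψ.toLp 2) =
      inner ℂ (φ.toLp 2) ((positionOp p ψ).toLp 2) := by
  simp only [inner_toL2_toL2_eq, positionOp_apply, RCLike.inner_apply, map_mul,
    Complex.conj_ofReal, mul_assoc, mul_left_comm]

variable [DecidableEq ι]

/-- The partial derivative in the direction of the coordinate `x_p`, on Schwartz functions. -/
def partialDerivOp (p : ι) : 𝓢(EuclideanSpace ℝ ι, ℂ) →ₗ[ℂ] 𝓢(EuclideanSpace ℝ ι, ℂ) :=
  (LineDeriv.lineDerivOpCLM ℂ 𝓢(EuclideanSpace ℝ ι, ℂ)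
    (EuclideanSpace.single p (1 : ℝ))).toLinearMap

theorem partialDerivOp_apply (p : ι) (φ : 𝓢(EuclideanSpace ℝ ι, ℂ)) (X : EuclideanSpace ℝ ι) :
    partialDerivOp p φ X = fderiv ℝ φ X (EuclideanSpace.single p 1) :=
  lineDerivOp_apply_eq_fderiv _ φ X

theorem partialDerivOp_comm (p q : ι) (φ : 𝓢(EuclideanSpace ℝ ι, ℂ)) :
    partialDerivOp p (partialDerivOp q φ) = partialDerivOp q (partialDerivOp p φ) := by
  ext X
  have hasFDerivAt_fderiv : HasFDerivAt (fderiv ℝ φ) (fderiv ℝ (fderiv ℝ φ) X) X :=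
    (((φ.smooth 2).fderiv_right le_rfl).differentiable one_ne_zero X).hasFDerivAt
  have apply_apply (p q : ι) : partialDerivOp p (partialDerivOp q φ) X =
      fderiv ℝ (fderiv ℝ φ) X (EuclideanSpace.single p 1) (EuclideanSpace.single q 1) := by
    rw [partialDerivOp_apply, show ⇑(partialDerivOp q φ) = _ from
      funext (partialDerivOp_apply q φ),
      (hasFDerivAt_fderiv.clm_apply (hasFDerivAt_const _ X)).fderiv]
    simp
  have h_symm : IsSymmSndFDerivAt ℝ φ X := (φ.smooth 2).contDiffAt.isSymmSndFDerivAt (by simp)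
  rw [apply_apply, apply_apply, h_symm.eq]

theorem partialDerivOp_positionOp (p q : ι) (φ : 𝓢(EuclideanSpace ℝ ι, ℂ)) :
    partialDerivOp p (positionOp q φ) =
      positionOp q (partialDerivOp p φ) + if p = q then φ else 0 := by
  ext X
  have hasFDerivAt_coord : HasFDerivAt (fun X : EuclideanSpace ℝ ι => ((X q : ℝ) : ℂ))
      (Complex.ofRealCLM ∘L EuclideanSpace.proj q) X :=
    (Complex.ofRealCLM ∘L EuclideanSpace.proj q).hasFDerivAt
  rw [partialDerivOp_apply, show ⇑(positionOp q φ) = _ from funext (positionOp_apply q φ),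
    (hasFDerivAt_coord.fun_mul (φ.hasFDerivAt X)).fderiv]
  rcases eq_or_ne p q with rfl | hpq
  · simp [positionOp_apply, partialDerivOp_apply]
  · simp [positionOp_apply, partialDerivOp_apply, hpq, hpq.symm]

theorem inner_partialDerivOp_left (p : ι) (φ ψ : 𝓢(EuclideanSpace ℝ ι, ℂ)) :
    inner ℂ ((partialDerivOp p φ).toLp 2) (ψ.toLp 2) =
      -inner ℂ (φ.toLp 2) ((partialDerivOp p ψ).toLp 2) := by
  have by_parts := integral_bilinear_lineDerivOp_right_eq_neg_left (μ := volume) φ ψ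
    ((ContinuousLinearMap.mul ℝ ℂ).comp (Complex.conjCLE : ℂ →L[ℝ] ℂ)) (EuclideanSpace.single p 1)
  simp only [inner_toL2_toL2_eq, RCLike.inner_apply']
  exact (neg_eq_iff_eq_neg.2 by_parts).symm

end CanonicalCommutation

/-! ### The operators `v_{j,k}` as infinitesimal rotations -/

section Creation

variable {m n : ℕ}

/-- The creation operator `(x_{i,j} - ∂/∂x_{i,j}) / √2` on Schwartz functions. -/
def creationSchwartz (i : Fin m) (j : Fin n) : 𝓢(MatSpace m n, ℂ) →ₗ[ℂ] 𝓢(MatSpace m n, ℂ) :=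
  ((Real.sqrt 2 : ℝ) : ℂ)⁻¹ • (positionOp (i, j) - partialDerivOp (i, j))

theorem annihilationSchwartz_eq_add (i : Fin m) (j : Fin n) :
    annihilationSchwartz i j =
      ((Real.sqrt 2 : ℝ) : ℂ)⁻¹ • (positionOp (i, j) + partialDerivOp (i, j)) := rfl

theorem inner_creationSchwartz_left (i : Fin m) (j : Fin n) (φ ψ : 𝓢(MatSpace m n, ℂ)) :
    inner ℂ ((creationSchwartz i j φ).toLp 2) (ψ.toLp 2) =
      inner ℂ (φ.toLp 2) ((annihilationSchwartz i j ψ).toLp 2) := by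
  have h_position := inner_positionOp_left (i, j) φ ψ
  have h_deriv := inner_partialDerivOp_left (i, j) φ ψ
  simp only [← toLpCLM_apply (𝕜 := ℂ)] at h_position h_deriv ⊢
  simp only [annihilationSchwartz_eq_add, creationSchwartz, LinearMap.smul_apply,
    LinearMap.sub_apply, LinearMap.add_apply, map_smul, map_sub, map_add, inner_smul_left,
    inner_smul_right, inner_sub_left, inner_add_right, h_position, h_deriv, map_inv₀,
    Complex.conj_ofReal, sub_neg_eq_add]

theorem creationSchwartz_annihilationSchwartz_sub (i : Fin m) (j k : Fin n)
    (φ : 𝓢(MatSpace m n, ℂ)) :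
    creationSchwartz i k (annihilationSchwartz i j φ) -
        creationSchwartz i j (annihilationSchwartz i k φ) =
      positionOp (i, k) (partialDerivOp (i, j) φ) -
        positionOp (i, j) (partialDerivOp (i, k) φ) := by
  have two_mul_inv_sqrt_two_sq : 2 * ((Real.sqrt 2 : ℝ) : ℂ)⁻¹ ^ 2 = 1 := by
    rw [inv_pow, ← Complex.ofReal_pow, Real.sq_sqrt two_pos.le, Complex.ofReal_ofNat,
      mul_inv_cancel₀ two_ne_zero]
  simp only [creationSchwartz, annihilationSchwartz_eq_add, LinearMap.smul_apply, map_smul,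
    LinearMap.sub_apply, LinearMap.add_apply, map_add,
    positionOp_comm (i, k) (i, j), partialDerivOp_comm (i, k) (i, j), partialDerivOp_positionOp,
    Prod.mk.injEq, true_and, eq_comm (a := k) (b := j)]
  linear_combination (norm := module) two_mul_inv_sqrt_two_sq •
    (positionOp (i, k) (partialDerivOp (i, j) φ) - positionOp (i, j) (partialDerivOp (i, k) φ))

theorem linearFieldDeriv_mulRightCLM_rotationGenerator (j k : Fin n) (φ : 𝓢(MatSpace m n, ℂ)) :
    linearFieldDeriv (MatSpace.mulRightCLM m (rotationGenerator j k)) φ =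
      ∑ i, (positionOp (i, k) (partialDerivOp (i, j) φ) -
        positionOp (i, j) (partialDerivOp (i, k) φ)) := by
  ext X
  have mulRight_eq : X.mulRight (rotationGenerator j k) =
      ∑ i, (X (i, k) • EuclideanSpace.single (i, j) (1 : ℝ) -
        X (i, j) • EuclideanSpace.single (i, k) (1 : ℝ)) := by
    ext ⟨a, b⟩
    simp [MatSpace.mulRight_apply, rotationGenerator, Matrix.single_apply, Pi.single_apply, mul_sub,
      ite_and, eq_comm]
  simp [linearFieldDeriv_apply, MatSpace.mulRightCLM_apply, mulRight_eq, positionOp_apply,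
    partialDerivOp_apply]

theorem sum_opComp_annihilation [NeZero m] (j k : Fin n) :
    ∑ i : Fin m, (opComp (annihilation i k).adjoint (annihilation i j) -
        opComp (annihilation i j).adjoint (annihilation i k)) =
      schwartzOperator (linearFieldDeriv (MatSpace.mulRightCLM m (rotationGenerator j k))) := by
  let a (i : Fin m) (j : Fin n) := schwartzOperator (annihilationSchwartz i j)
  set S := ∑ i : Fin m, (opComp (a i k).adjoint (a i j) - opComp (a i j).adjoint (a i k)) with hS
  have mem_graph_opComp (i : Fin m) (j k : Fin n) (φ : 𝓢(MatSpace m n, ℂ)) :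
      (φ.toLp 2 volume, (creationSchwartz i k (annihilationSchwartz i j φ)).toLp 2 volume) ∈
        (opComp (a i k).adjoint (a i j)).graph :=
    mem_graph_opComp_iff.2 ⟨_, mem_graph_schwartzOperator.2 ⟨φ, rfl, rfl⟩,
      mem_graph_adjoint_schwartzOperator (inner_creationSchwartz_left i k) _⟩
  change S = _
  have le_sum :
      schwartzOperator (linearFieldDeriv (MatSpace.mulRightCLM m (rotationGenerator j k))) ≤ S := by
    refine LinearPMap.le_of_le_graph ?_
    rintro ⟨f, g⟩ hfg
    obtain ⟨φ, rfl, rfl⟩ := mem_graph_schwartzOperator.1 hfg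
    simp_rw [linearFieldDeriv_mulRightCLM_rotationGenerator,
      ← creationSchwartz_annihilationSchwartz_sub]
    have := mem_graph_sum (s := Finset.univ) fun (i : Fin m) _ =>
      mem_graph_sub (mem_graph_opComp i j k φ) (mem_graph_opComp i k j φ)
    simpa only [← toLpCLM_apply (𝕜 := ℂ), map_sum, map_sub] using this
  refine (LinearPMap.eq_of_le_of_domain_eq le_sum (le_antisymm le_sum.1 fun f hf => ?_)).symm
  simp only [hS, domain_sum, Submodule.mem_iInf] at hf
  obtain ⟨hf0, -⟩ := (mem_opComp_domain _ _ _).1 (hf 0 (Finset.mem_univ 0)).1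
  exact hf0

end Creation

section Rotations

open LieAlgebra.Orthogonal

variable {m n : ℕ} [NeZero m]

theorem isUnitaryGroupOf_vOp (j k : Fin n) :
    IsUnitaryGroupOf (vOp (m := m) j k) fun t =>
      compUnitary (matRotation m
        (t • (⟨rotationGenerator j k, rotationGenerator_mem_so j k⟩ : so (Fin n) ℝ))) := by
  rw [vOp, sum_opComp_annihilation]
  exact (isIsometricFlow_matRotation
    ⟨rotationGenerator j k, rotationGenerator_mem_so j k⟩).isUnitaryGroupOf_closure

theorem exists_isUnitaryGroupOf_rOp (k : Fin (n - 1)) :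
    ∃ A : so (Fin n) ℝ,
      IsUnitaryGroupOf (rOp m n k) fun t => compUnitary (matRotation m (t • A)) := by
  have arctan_ne_zero : Real.arctan (Real.sqrt ((k : ℝ) + 1)) ≠ 0 :=
    (Real.arctan_pos.2 (by positivity)).ne'
  refine ⟨Real.arctan (Real.sqrt ((k : ℝ) + 1)) •
    ⟨rotationGenerator ⟨k, by omega⟩ ⟨k + 1, by omega⟩, rotationGenerator_mem_so _ _⟩, ?_⟩
  simp_rw [smul_comm _ (Real.arctan _), ← mul_smul]
  exact (isUnitaryGroupOf_vOp _ _).smul arctan_ne_zero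

end Rotations

/-! ### Invariance under rotations -/

section Invariance

open LieAlgebra.Orthogonal

variable {m n : ℕ}

/-- The matrices `B` for which `f` is annihilated, in the weak sense, by the derivative along the
vector field `X ↦ X B`. -/
def infinitesimalStabilizer (f : HilbertMN m n) : LieSubalgebra ℝ (Matrix (Fin n) (Fin n) ℝ) where
  carrier := {B | ∀ φ : 𝓢(MatSpace m n, ℂ),
    inner ℂ f ((linearFieldDeriv (MatSpace.mulRightCLM m B) φ).toLp 2) = 0}
  zero_mem' φ := by
    rw [← toLpCLM_apply (𝕜 := ℂ)]
    simp only [map_zero, LinearMap.zero_apply, inner_zero_right]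
  add_mem' hA hB φ := by
    rw [← toLpCLM_apply (𝕜 := ℂ), map_add, map_add, LinearMap.add_apply, map_add, inner_add_right,
      toLpCLM_apply, toLpCLM_apply, hA, hB, add_zero]
  smul_mem' c A hA φ := by
    have smul_eq (ψ : 𝓢(MatSpace m n, ℂ)) : c • ψ = (c : ℂ) • ψ := by ext; simp
    rw [← toLpCLM_apply (𝕜 := ℂ), map_smul, map_smul, LinearMap.smul_apply, smul_eq, map_smul,
      inner_smul_right, toLpCLM_apply, hA, mul_zero]
  lie_mem' {A B} hA hB φ := by
    rw [MatSpace.mulRightCLM_lie, ← linearFieldDeriv_commutator, ← toLpCLM_apply (𝕜 := ℂ), map_sub,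
      inner_sub_right, toLpCLM_apply, toLpCLM_apply, hA, hB, sub_zero]

theorem mem_infinitesimalStabilizer_iff {f : HilbertMN m n} {A : so (Fin n) ℝ} :
    A.1 ∈ infinitesimalStabilizer f ↔ ∀ t : ℝ,
      (compUnitary (matRotation m (t • A)) : HilbertMN m n →L[ℂ] HilbertMN m n) f = f :=
  (isIsometricFlow_matRotation A).forall_compUnitary_apply_eq_iff.symm

theorem isMwRI_iff_so_le_infinitesimalStabilizer {f : HilbertMN m n} :
    IsMwRI f ↔ so (Fin n) ℝ ≤ infinitesimalStabilizer f := by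
  simp only [isMwRI_iff_compUnitary_apply_eq, ← mem_infinitesimalStabilizer_iff]
  exact Subtype.forall

theorem isMwRI_iff_rotationGenerator_mem {f : HilbertMN m n} (l : Fin n) :
    IsMwRI f ↔ ∀ k, rotationGenerator k l ∈ infinitesimalStabilizer f := by
  rw [isMwRI_iff_so_le_infinitesimalStabilizer, ← lieSpan_range_rotationGenerator l,
    LieSubalgebra.lieSpan_le, Set.range_subset_iff]
  rfl

theorem mem_nullSpace_iff {L : HilbertMN m n →ₗ.[ℂ] HilbertMN m n} {f : HilbertMN m n} :
    f ∈ nullSpace L ↔ (f, 0) ∈ L.graph :=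
  ⟨fun ⟨h, h0⟩ => L.mem_graph_iff.2 ⟨⟨f, h⟩, rfl, h0⟩, fun h => by
    obtain ⟨y, rfl, hy⟩ := L.mem_graph_iff.1 h
    exact ⟨y.2, hy⟩⟩

theorem nullSpace_TInv_subset_KSet_zero : nullSpace (TInv m n) ⊆ KSet m n 0 := by
  rintro f ⟨h, h0⟩
  exact ⟨h, by simp [h0]⟩

variable [NeZero m]

theorem mem_graph_adjoint_vOp_zero_iff {f : HilbertMN m n} (j k : Fin n) :
    (f, 0) ∈ (vOp j k).adjoint.graph ↔ rotationGenerator j k ∈ infinitesimalStabilizer f :=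
  (isUnitaryGroupOf_vOp j k).mem_graph_adjoint_zero_iff.trans
    (mem_infinitesimalStabilizer_iff
      (A := ⟨rotationGenerator j k, rotationGenerator_mem_so j k⟩)).symm

theorem forall_mem_graph_adjoint_vLast_zero_iff [NeZero n] {f : HilbertMN m n} :
    (∀ k, (f, 0) ∈ (vLast m n k).adjoint.graph) ↔ IsMwRI f := by
  rw [isMwRI_iff_rotationGenerator_mem ⟨n - 1, Nat.sub_one_lt (NeZero.ne n)⟩]
  simp only [vLast, mem_graph_adjoint_vOp_zero_iff]
  refine ⟨fun h k => ?_, fun h k => h _⟩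
  rcases (Nat.le_sub_one_of_lt k.2).lt_or_eq with hk | hk
  · exact h ⟨k, hk⟩
  · rw [Fin.ext (b := ⟨n - 1, Nat.sub_one_lt (NeZero.ne n)⟩) hk, rotationGenerator, sub_self]
    exact zero_mem _

theorem IsMwRI.ROp_mem_stabilizer {f : HilbertMN m n} (hf : IsMwRI f) :
    ROp m n ∈ MulAction.stabilizer (unitary (HilbertMN m n →L[ℂ] HilbertMN m n)) f := by
  refine list_prod_mem fun u hu => ?_
  obtain ⟨k, rfl⟩ := List.mem_ofFn.1 (List.mem_reverse.1 hu)
  obtain ⟨A, hA⟩ := exists_isUnitaryGroupOf_rOp (m := m) k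
  rw [hA.unitaryExp_eq]
  exact isMwRI_iff_compUnitary_apply_eq.1 hf A 1

theorem isMwRI_ROp_apply_iff {f : HilbertMN m n} :
    IsMwRI ((ROp m n : HilbertMN m n →L[ℂ] HilbertMN m n) f) ↔ IsMwRI f := by
  have apply_eq {f : HilbertMN m n} (hf : IsMwRI f) : ROp m n • f = f := hf.ROp_mem_stabilizer
  change IsMwRI (ROp m n • f) ↔ _
  refine ⟨fun hf => ?_, fun hf => (apply_eq hf).symm ▸ hf⟩
  rwa [← smul_left_cancel (ROp m n) (apply_eq hf)]

theorem IsMwRI.mem_nullSpace_TInv [NeZero n] {f : HilbertMN m n} (hf : IsMwRI f) :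
    f ∈ nullSpace (TInv m n) :=
  mem_nullSpace_iff.2 <| mem_graph_sumConjSq_zero <|
    forall_mem_graph_adjoint_vLast_zero_iff.2 <| isMwRI_ROp_apply_iff.2 hf

theorem isMwRI_of_mem_KSet_zero [NeZero n] {f : HilbertMN m n} (hf : f ∈ KSet m n 0) :
    IsMwRI f := by
  obtain ⟨h, hle⟩ := hf
  refine isMwRI_ROp_apply_iff.1 (forall_mem_graph_adjoint_vLast_zero_iff.1 ?_)
  exact mem_graph_adjoint_zero_of_re_inner_nonpos
    (fun k => (isUnitaryGroupOf_vOp _ _).dense_domain) ((TInv m n).mem_graph ⟨f, h⟩)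
    (by simpa using hle)

end Invariance

/-! ### Radial functions -/

section Radial

open LieAlgebra.Orthogonal

section Euclidean

variable {E : Type*} [NormedAddCommGroup E] [InnerProductSpace ℝ E]

theorem exists_norm_eq_one_eq_norm_smul {V : Type*} [NormedAddCommGroup V] [NormedSpace ℝ V]
    [Nontrivial V] (v : V) : ∃ u : V, ‖u‖ = 1 ∧ v = ‖v‖ • u := by
  rcases eq_or_ne v 0 with rfl | hv
  · obtain ⟨u, hu⟩ := exists_norm_eq V zero_le_one
    exact ⟨u, hu, by simp⟩
  · exact ⟨‖v‖⁻¹ • v, norm_smul_inv_norm (𝕜 := ℝ) hv,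
      (smul_inv_smul₀ (norm_ne_zero_iff.2 hv) v).symm⟩

theorem exists_orthogonal_eq_cos_smul_add_sin_smul (hE : 2 ≤ Module.finrank ℝ E) {X Y : E}
    (hX : X ≠ 0) (hXY : ‖X‖ = ‖Y‖) :
    ∃ (Z : E) (θ : ℝ), ‖Z‖ = ‖X‖ ∧ inner ℝ X Z = 0 ∧ Y = Real.cos θ • X + Real.sin θ • Z := by
  have := Module.finite_of_finrank_pos (two_pos.trans_le hE)
  set θ := InnerProductGeometry.angle X Y
  set W := Y - Real.cos θ • X with hW
  have inner_eq : inner ℝ X Y = Real.cos θ * ‖X‖ ^ 2 := by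
    rw [← InnerProductGeometry.cos_angle_mul_norm_mul_norm, ← hXY, pow_two]
  have inner_W : inner ℝ X W = 0 := by
    rw [hW, inner_sub_right, inner_smul_right, inner_eq, real_inner_self_eq_norm_sq, sub_self]
  have norm_W : ‖W‖ = Real.sin θ * ‖X‖ := by
    rw [← sq_eq_sq₀ (norm_nonneg _) (mul_nonneg (InnerProductGeometry.sin_angle_nonneg X Y)
      (norm_nonneg _)), hW, norm_sub_sq_real, inner_smul_right, real_inner_comm, inner_eq,
      norm_smul, ← hXY, Real.norm_eq_abs, mul_pow, mul_pow, sq_abs, Real.sin_sq]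
    ring
  have : Nontrivial (ℝ ∙ X)ᗮ := by
    apply Module.nontrivial_of_finrank_pos (R := ℝ)
    have := (ℝ ∙ X).finrank_add_finrank_orthogonal
    rw [finrank_span_singleton hX] at this
    omega
  obtain ⟨u, norm_u, W_eq⟩ := exists_norm_eq_one_eq_norm_smul
    (⟨W, Submodule.mem_orthogonal_singleton_iff_inner_right.2 inner_W⟩ : (ℝ ∙ X)ᗮ)
  refine ⟨‖X‖ • u, θ, ?_, ?_, ?_⟩
  · rw [norm_smul, norm_norm, Submodule.norm_coe, norm_u, mul_one]
  · rw [inner_smul_right, Submodule.mem_orthogonal_singleton_iff_inner_right.1 u.2, mul_zero]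
  · rw [smul_smul, ← norm_W, ← sub_eq_iff_eq_add']
    exact congrArg Subtype.val W_eq

theorem IsIsometricFlow.apply_eq_cos_smul_add_sin_smul {D : E →L[ℝ] E} {V : ℝ → E ≃ₗᵢ[ℝ] E}
    (hV : IsIsometricFlow D V) {X Z : E} (hX : D X = Z) (hZ : D Z = -X) (t : ℝ) :
    V t X = Real.cos t • X + Real.sin t • Z := by
  refine congrFun (ODE_solution_unique_univ (v := fun _ => D) (s := fun _ => Set.univ) (t₀ := 0)
    (f := fun t => V t X) (g := fun t => Real.cos t • X + Real.sin t • Z)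
    (fun _ => D.lipschitz.lipschitzOnWith) (fun t => ⟨hV.hasDerivAt X t, trivial⟩)
    (fun t => ⟨?_, trivial⟩) ?_) t
  · refine (((Real.hasDerivAt_cos t).smul_const X).add
      ((Real.hasDerivAt_sin t).smul_const Z)).congr_deriv ?_
    rw [_root_.map_add, map_smul, map_smul, hX, hZ]
    module
  · simp [hV.map_zero]

variable [FiniteDimensional ℝ E] [MeasurableSpace E] [BorelSpace E]
  {F : Type*} [NormedAddCommGroup F] [NormedSpace ℝ F]

theorem setAverage_closedBall_apply (e : E ≃ₗᵢ[ℝ] E) {f : E → F} (hf : ∀ᵐ X, f X = f (e X))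
    (X : E) (r : ℝ) :
    ⨍ Y in Metric.closedBall (e X) r, f Y = ⨍ Y in Metric.closedBall X r, f Y := by
  have preimage_eq : e ⁻¹' Metric.closedBall (e X) r = Metric.closedBall X r := by simp
  have e_measurePreserving := e.measurePreserving
  have integral_eq :
      ∫ Y in Metric.closedBall (e X) r, f Y = ∫ Y in Metric.closedBall X r, f Y := by
    rw [← e_measurePreserving.setIntegral_preimage_emb e.toHomeomorph.measurableEmbedding,
      preimage_eq]
    exact integral_congr_ae (ae_restrict_of_ae (hf.mono fun Y h => h.symm))
  rw [setAverage_eq, setAverage_eq, integral_eq, measureReal_def, measureReal_def, ← preimage_eq,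
    e_measurePreserving.measure_preimage measurableSet_closedBall.nullMeasurableSet]

theorem exists_ae_eq_comp_norm [CompleteSpace F] {f : E → F} (hf : LocallyIntegrable f)
    (h_trans : ∀ X Y : E, ‖X‖ = ‖Y‖ → ∃ e : E ≃ₗᵢ[ℝ] E, e X = Y ∧ ∀ᵐ Z, f Z = f (e Z)) :
    ∃ g : ℝ → F, ∀ᵐ X, f X = g ‖X‖ := by
  -- The averages of `f` over balls, unlike `f` itself, are constant on every sphere.
  let average (X : E) (r : ℝ) : F := ⨍ Y in Metric.closedBall X r, f Y
  let averageLim (X : E) : F := Filter.limUnder (nhdsWithin 0 (Set.Ioi 0)) (average X)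
  have factorsThrough_norm : averageLim.FactorsThrough norm := fun X Y hXY => by
    obtain ⟨e, rfl, he⟩ := h_trans X Y hXY
    have average_eq : average (e X) = average X := funext (setAverage_closedBall_apply e he X)
    simp only [averageLim, average_eq]
  refine ⟨Function.extend norm averageLim 0, ?_⟩
  filter_upwards [(Besicovitch.vitaliFamily (volume : Measure E)).ae_tendsto_average hf] with X hX
  rw [factorsThrough_norm.extend_apply]
  exact (hX.comp (Besicovitch.tendsto_filterAt volume X)).limUnder_eq.symm

end Euclidean

variable {n : ℕ}

theorem MatSpace.mulRight_transpose_mul (X V Z : MatSpace 1 n) :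
    V.mulRight (X.toMatrixᵀ * Z.toMatrix) = inner ℝ X V • Z := by
  ext ⟨i, j⟩
  obtain rfl := Subsingleton.elim i 0
  simp [MatSpace.mulRight_apply, MatSpace.toMatrix, Matrix.mul_apply, PiLp.inner_apply,
    Fintype.sum_prod_type, Finset.sum_mul, mul_assoc]

theorem exists_so_forall_mulRight_eq (X Z : MatSpace 1 n) :
    ∃ J : so (Fin n) ℝ, ∀ V : MatSpace 1 n,
      V.mulRight J.1 = inner ℝ X V • Z - inner ℝ Z V • X := by
  refine ⟨⟨X.toMatrixᵀ * Z.toMatrix - Z.toMatrixᵀ * X.toMatrix, ?_⟩, fun V => ?_⟩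
  · simp [mem_so, Matrix.transpose_sub]
  · rw [← MatSpace.mulRightCLM_apply, map_sub, _root_.sub_apply, MatSpace.mulRightCLM_apply,
      MatSpace.mulRightCLM_apply, MatSpace.mulRight_transpose_mul, MatSpace.mulRight_transpose_mul]

theorem exists_matRotation_apply_eq (hn : 2 ≤ n) {X Y : MatSpace 1 n} (hXY : ‖X‖ = ‖Y‖) :
    ∃ A : so (Fin n) ℝ, matRotation 1 A X = Y := by
  rcases eq_or_ne X 0 with rfl | hX
  · exact ⟨0, by rw [map_zero, eq_comm, ← norm_eq_zero, ← hXY, norm_zero]⟩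
  obtain ⟨Z, θ, norm_Z, inner_XZ, rfl⟩ :=
    exists_orthogonal_eq_cos_smul_add_sin_smul (by simpa using hn) hX hXY
  have norm_sq_ne_zero : ‖X‖ ^ 2 ≠ 0 := pow_ne_zero 2 (norm_ne_zero_iff.2 hX)
  obtain ⟨J, hJ⟩ := exists_so_forall_mulRight_eq X ((‖X‖ ^ 2)⁻¹ • Z)
  refine ⟨θ • J, (isIsometricFlow_matRotation J).apply_eq_cos_smul_add_sin_smul ?_ ?_ θ⟩
  · rw [MatSpace.mulRightCLM_apply, hJ, inner_smul_left, real_inner_self_eq_norm_sq,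
      real_inner_comm, inner_XZ, mul_zero, zero_smul, sub_zero, smul_inv_smul₀ norm_sq_ne_zero]
  · rw [MatSpace.mulRightCLM_apply, hJ, inner_smul_left, real_inner_self_eq_norm_sq, norm_Z,
      inner_XZ, zero_smul, zero_sub, RCLike.conj_to_real, inv_mul_cancel₀ norm_sq_ne_zero, one_smul]

theorem isMwRI_iff_isRadial (hn : 2 ≤ n) {f : HilbertMN 1 n} : IsMwRI f ↔ IsRadial f := by
  simp only [isMwRI_iff_compUnitary_apply_eq, compUnitary_apply_eq_self_iff]
  constructor
  · intro hf
    refine exists_ae_eq_comp_norm ((Lp.memLp f).locallyIntegrable one_le_two) fun X Y hXY => ?_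
    obtain ⟨A, hA⟩ := exists_matRotation_apply_eq hn hXY
    exact ⟨_, hA, by simpa using hf A 1⟩
  · rintro ⟨g, hg⟩ A t
    filter_upwards [hg,
      (matRotation 1 (t • A)).measurePreserving.quasiMeasurePreserving.ae hg] with X hX h_rotate
    rw [hX, h_rotate, LinearIsometryEquiv.norm_map]

end Radial

end

theorem mainTheorem5 (m n : ℕ) (hm : 1 ≤ m) (hn : 2 ≤ n) :
    (∀ k : Fin (n - 1), ∃ U : ℝ → unitary (HilbertMN m n →L[ℂ] HilbertMN m n),
      IsUnitaryGroupOf (rOp m n k) U) ∧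
    KSet m n 0 = nullSpace (TInv m n) ∧
    KSet m n 0 = {f : HilbertMN m n | IsMwRI f} ∧
    (m = 1 → KSet m n 0 = {f : HilbertMN m n | IsRadial f}) := by
  have : NeZero m := ⟨by omega⟩
  have : NeZero n := ⟨by omega⟩
  have KSet_eq_isMwRI : KSet m n 0 = {f : HilbertMN m n | IsMwRI f} :=
    Set.Subset.antisymm (fun f hf => isMwRI_of_mem_KSet_zero hf)
      fun f hf => nullSpace_TInv_subset_KSet_zero (IsMwRI.mem_nullSpace_TInv hf)
  refine ⟨fun k => ?_, ?_, KSet_eq_isMwRI, ?_⟩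
  · obtain ⟨A, hA⟩ := exists_isUnitaryGroupOf_rOp (m := m) k
    exact ⟨_, hA⟩
  · exact Set.Subset.antisymm (fun f hf => (isMwRI_of_mem_KSet_zero hf).mem_nullSpace_TInv)
      nullSpace_TInv_subset_KSet_zero
  · rintro rfl
    rw [KSet_eq_isMwRI]
    exact Set.ext fun f => isMwRI_iff_isRadial hn
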